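/- Let $(X,d)$ be a proper metric space (every bounded subset is relatively compact) and let $\mu$ be a Radon measure on $X$ (a regular Borel measure that is finite on compact sets) with support $X$. Let $p\in[1,\infty)$, let $E$ be a complex Banach space, and let $C_b(X)$ (bounded continuous complex-valued functions, sup norm) act on the Bochner space $L^p(X;E)$ by pointwise multiplication; write $fT$, $Tf$ for the products of $T\in\mathfrak B(L^p(X;E))$ with the multiplication operator of $f\in C_b(X)$, and $[T,f]=Tf-fT$. Let $\operatorname{supp} f$ denote the closed support, let $d(S,T)=\inf\{d(x,y):x\in S,\ y\in T\}$ for $S,T\subseteq X$ ($=\infty$ if $S$ or $T$ is empty), and let $C_0(X)$ be the continuous functions vanishing at infinity. Let $B\subseteq\mathfrak B(L^p(X;E))$ be a norm-closed (not necessarily unital) subalgebra such that $C_b(X)BC_b(X)=B$ and such that $B$ is closed under block cutdowns: for every $a\in B$ and every uniformly equicontinuous family $(e_j)_{j\in J}$ in $C_b(X)$ with $0\le e_j\le 1$ and pairwise disjoint supports, the operator $\sum_{j\in J}e_jae_j$ (convergence in the strong operator topology) belongs to $B$. Definitions. - For a Banach algebra $A$, $A_\infty$ is the algebra of bounded sequences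 in $A$ modulo the sequences converging to $0$ in norm; $A\subseteq A_\infty$ as constant sequences. A bounded sequence $(f_n)$ in $C_b(X)$ is very Lipschitz if for every $L>0$ there is $n_0$ such that $f_n$ is $L$-Lipschitz for all $n\ge n_0$. $\mathrm{VL}_\infty(X)$ is the set of classes of very Lipschitz sequences, viewed in $\mathfrak B(L^p(X;E))_\infty$ via multiplication operators. - $a$ has propagation at most $R$ if $faf'=0$ for all $f,f'\in C_b(X)$ with $d(\operatorname{supp}f,\operatorname{supp}f')>R$. It is quasi-local if for every $\varepsilon>0$ there is $R\ge0$ such that $\|faf'\|<\varepsilon$ for all $f,f'\in C_b(X)$ with $\|f\|,\|f'\|\le1$ and $d(\operatorname{supp}f,\operatorname{supp}f')>R$. - $\mathrm{Roe}(X,B)$ is the norm closure of the set of operators in $B$ of finite propagation, and $\mathcal K(X,B)$ is the norm closure of $C_0(X)BC_0(X)$. - $g\in C_b(X)$ is a Higson function if for all $R,\varepsilon>0$ there is a compact $A\subseteq X$ such that $|g(x)-g(y)|<\varepsilon$ whenever $x,y\in X\setminus A$ and $d(x,y)<R$. - For sets $\mathcal X,\mathcal Y$ of subsets of $X$ and $R\ge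 0$, write $\mathcal X\xrightarrow{R}\mathcal Y$ if every $Z\in\mathcal X$ is a union $Z=Z_0\cup Z_1$ where each $Z_i$ is a union of members of $\mathcal Y$ such that any two different ones are at distance $>R$. $X$ has straight finite decomposition complexity if for every sequence $0\le R_1<R_2<\cdots$ there are $m\in\mathbb N$ and sets of subsets $\{X\}=\mathcal X_0,\mathcal X_1,\dots,\mathcal X_m$ with $\mathcal X_{i-1}\xrightarrow{R_i}\mathcal X_i$ for $i=1,\dots,m$ and with the diameters of the members of $\mathcal X_m$ uniformly bounded. Theorem. For $b\in B$ the following are equivalent: (i) $[b,f]=0$ in $\mathfrak B(L^p(X;E))_\infty$ for all $f\in\mathrm{VL}_\infty(X)$; (ii) $b$ is quasi-local; (iii) $[b,g]\in\mathcal K(X,B)$ for every Higson function $g$ on $X$. If $X$ has straight finite decomposition complexity, these are also equivalent to (iv) $b\in\mathrm{Roe}(X,B)$. -/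

import Mathlib

open Filter Topology MeasureTheory
open scoped ENNReal NNReal BoundedContinuousFunction ZeroAtInfty ComplexOrder

universe u v

namespace RoeLike

/-! ### The algebra of bounded sequences modulo null sequences -/

section Sequences

variable (A : Type*) [NormedRing A]

/-- The ring of norm-bounded sequences in `A`. -/
def boundedSeq : Subring (ℕ → A) where
  carrier := {a | ∃ C : ℝ, ∀ n, ‖a n‖ ≤ C}
  mul_mem' := by
    rintro a b ⟨C, hC⟩ ⟨D, hD⟩
    refine ⟨C * D, fun n => (norm_mul_le _ _).trans ?_⟩
    exact mul_le_mul (hC n) (hD n) (norm_nonneg _) ((norm_nonneg _).trans (hC n))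
  one_mem' := ⟨‖(1 : A)‖, fun _ => le_rfl⟩
  add_mem' := by
    rintro a b ⟨C, hC⟩ ⟨D, hD⟩
    exact ⟨C + D, fun n => (norm_add_le _ _).trans (add_le_add (hC n) (hD n))⟩
  zero_mem' := ⟨0, fun n => by simp⟩
  neg_mem' := by
    rintro a ⟨C, hC⟩
    exact ⟨C, fun n => by simpa using hC n⟩

/-- The ideal of the bounded sequences that converge to `0` in norm. -/
def nullSeq : Ideal (boundedSeq A) where
  carrier := {a | Tendsto (fun n => ‖a.1 n‖) atTop (𝓝 0)}
  add_mem' := by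
    intro a b ha hb
    refine squeeze_zero (fun n => norm_nonneg _) (fun n => norm_add_le (a.1 n) (b.1 n)) ?_
    simpa using Tendsto.add ha hb
  zero_mem' := by simp
  smul_mem' := by
    rintro ⟨c, C, hC⟩ x hx
    refine squeeze_zero (g := fun n => C * ‖x.1 n‖) (fun n => norm_nonneg _) (fun n => ?_) ?_
    · exact (norm_mul_le (c n) (x.1 n)).trans
        (mul_le_mul_of_nonneg_right (hC n) (norm_nonneg _))
    · simpa using Tendsto.const_mul C hx

instance nullSeq_isTwoSided : (nullSeq A).IsTwoSided where
  mul_mem_of_left := by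
    rintro x ⟨c, C, hC⟩ hx
    refine squeeze_zero (g := fun n => ‖x.1 n‖ * C) (fun n => norm_nonneg _) (fun n => ?_) ?_
    · exact (norm_mul_le (x.1 n) (c n)).trans
        (mul_le_mul_of_nonneg_left (hC n) (norm_nonneg _))
    · simpa using Tendsto.mul_const C hx

/-- The algebra `A_∞ = ℓ^∞(ℕ, A) / {null sequences}`. -/
def SeqAlg : Type _ := boundedSeq A ⧸ nullSeq A

noncomputable instance SeqAlg.instRing : Ring (SeqAlg A) := Ideal.Quotient.ring (nullSeq A)

variable {A}

/-- The class of a bounded sequence in `A_∞`. -/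
noncomputable def SeqAlg.mk (a : ℕ → A) (ha : ∃ C : ℝ, ∀ n, ‖a n‖ ≤ C) : SeqAlg A :=
  Ideal.Quotient.mk (nullSeq A) ⟨a, ha⟩

/-- The inclusion of `A` in `A_∞` as (classes of) constant sequences. -/
noncomputable def SeqAlg.const (a : A) : SeqAlg A :=
  SeqAlg.mk (fun _ => a) ⟨‖a‖, fun _ => le_rfl⟩

/-- `[a, (f n)] = 0` in `A_∞` means that `‖[a, f n]‖` tends to `0`. -/
theorem SeqAlg.const_comm_iff (a : A) (f : ℕ → A) (hf : ∃ C : ℝ, ∀ n, ‖f n‖ ≤ C) :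
    SeqAlg.const a * SeqAlg.mk f hf - SeqAlg.mk f hf * SeqAlg.const a = 0 ↔
      Tendsto (fun n => ‖a * f n - f n * a‖) atTop (𝓝 0) := by
  have h : SeqAlg.const a * SeqAlg.mk f hf - SeqAlg.mk f hf * SeqAlg.const a =
      Ideal.Quotient.mk (nullSeq A)
        ((⟨fun _ => a, ‖a‖, fun _ => le_rfl⟩ : boundedSeq A) * ⟨f, hf⟩ -
          ⟨f, hf⟩ * ⟨fun _ => a, ‖a‖, fun _ => le_rfl⟩) := rfl
  rw [h]
  exact Ideal.Quotient.eq_zero_iff_mem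

end Sequences

/-! ### Coarse geometry -/

section Coarse

variable {X : Type u} [MetricSpace X]

/-- The distance `d(S, T)` of two subsets, equal to `∞` if one of them is empty. -/
noncomputable def setDist (S T : Set X) : ℝ≥0∞ :=
  ⨅ x ∈ S, ⨅ y ∈ T, edist x y

/-- A set of subsets is `R`-disjoint if any two different members are at distance `> R`. -/
def RDisjoint (R : ℝ) (𝒴 : Set (Set X)) : Prop :=
  ∀ Y ∈ 𝒴, ∀ Y' ∈ 𝒴, Y ≠ Y' → ENNReal.ofReal R < setDist Y Y'

/-- `Z` can `R`-decompose over `𝒴`: `Z` is the union of two sets, each of which is the union of an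
`R`-disjoint family of members of `𝒴`. -/
def SetRDecomposes (R : ℝ) (Z : Set X) (𝒴 : Set (Set X)) : Prop :=
  ∃ 𝒜₀ ⊆ 𝒴, ∃ 𝒜₁ ⊆ 𝒴, RDisjoint R 𝒜₀ ∧ RDisjoint R 𝒜₁ ∧ Z = ⋃₀ 𝒜₀ ∪ ⋃₀ 𝒜₁

/-- `𝒳` can `R`-decompose over `𝒴`: every member of `𝒳` can. -/
def RDecomposes (R : ℝ) (𝒳 𝒴 : Set (Set X)) : Prop :=
  ∀ Z ∈ 𝒳, SetRDecomposes R Z 𝒴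

/-- A set of subsets is uniformly bounded if their diameters have a finite common bound. -/
def UniformlyBounded (𝒴 : Set (Set X)) : Prop :=
  ∃ C : ℝ, ∀ Y ∈ 𝒴, ∀ x ∈ Y, ∀ y ∈ Y, dist x y ≤ C

variable (X) in
/-- Straight finite decomposition complexity. The numbers `R₁ < R₂ < ⋯` are `R 0 < R 1 < ⋯`. -/
def HasSFDC : Prop :=
  ∀ R : ℕ → ℝ, 0 ≤ R 0 → StrictMono R →
    ∃ (m : ℕ) (𝒳 : ℕ → Set (Set X)), 𝒳 0 = {Set.univ} ∧
      (∀ i < m, RDecomposes (R i) (𝒳 i) (𝒳 (i + 1))) ∧ UniformlyBounded (𝒳 m)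

/-- Higson (slowly oscillating) functions. -/
def IsHigson (g : X →ᵇ ℂ) : Prop :=
  ∀ R > 0, ∀ ε > 0, ∃ A : Set X, IsCompact A ∧
    ∀ x ∉ A, ∀ y ∉ A, dist x y < R → ‖g x - g y‖ < ε

/-- Very Lipschitz bounded sequences in `C_b(X)`. -/
def IsVeryLipschitz (f : ℕ → X →ᵇ ℂ) : Prop :=
  (∃ C : ℝ, ∀ n, ‖f n‖ ≤ C) ∧
    ∀ L : ℝ≥0, 0 < L → ∃ n₀ : ℕ, ∀ n ≥ n₀, LipschitzWith L (f n)

/-- A uniformly equicontinuous family of positive contractions in `C_b(X)` whose (closed) supports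
are pairwise disjoint. -/
structure IsCutdownFamily {J : Type u} (e : J → X →ᵇ ℂ) : Prop where
  uniformEquicontinuous : UniformEquicontinuous fun j => (e j : X → ℂ)
  nonneg : ∀ j x, 0 ≤ e j x
  norm_le_one : ∀ j, ‖e j‖ ≤ 1
  disjoint_support : ∀ i j, i ≠ j → Disjoint (tsupport (e i)) (tsupport (e j))

end Coarse

/-! ### Operators on `L^p(X; E)` -/

section Operators

variable {X : Type u} [MetricSpace X] [MeasurableSpace X] [BorelSpace X]
  {E : Type v} [NormedAddCommGroup E] [NormedSpace ℂ E]
  {p : ℝ≥0∞} {μ : Measure X}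

theorem memLp_mul (f : X →ᵇ ℂ) (ξ : Lp E p μ) : MemLp (fun x => f x • ξ x) p μ := by
  refine (Lp.memLp ξ).of_le_mul (c := ‖f‖)
    (f.continuous.aestronglyMeasurable.smul (Lp.aestronglyMeasurable ξ)) (.of_forall fun x => ?_)
  rw [norm_smul]
  exact mul_le_mul_of_nonneg_right (f.norm_coe_le_norm x) (norm_nonneg _)

variable [Fact (1 ≤ p)]

variable (E p μ) in
/-- The multiplication representation of `C_b(X)` on `L^p(X; E)`, `(ρ(f) ξ)(x) = f(x) ξ(x)`. -/
noncomputable def rho (f : X →ᵇ ℂ) : Lp E p μ →L[ℂ] Lp E p μ :=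
  LinearMap.mkContinuous
    { toFun := fun ξ => (memLp_mul f ξ).toLp (fun x => f x • ξ x)
      map_add' := fun ξ η => by
        rw [← MemLp.toLp_add]
        refine MemLp.toLp_congr _ _ ?_
        filter_upwards [Lp.coeFn_add ξ η] with x hx
        rw [hx, Pi.add_apply, Pi.add_apply, smul_add]
      map_smul' := fun c ξ => by
        rw [RingHom.id_apply, ← MemLp.toLp_const_smul]
        refine MemLp.toLp_congr _ _ ?_
        filter_upwards [Lp.coeFn_smul c ξ] with x hx
        rw [hx, Pi.smul_apply, Pi.smul_apply, smul_comm] }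
    ‖f‖ fun ξ => by
      refine Lp.norm_le_mul_norm_of_ae_le_mul ?_
      filter_upwards [(memLp_mul f ξ).coeFn_toLp] with x hx
      simp only [LinearMap.coe_mk, AddHom.coe_mk, hx, norm_smul]
      exact mul_le_mul_of_nonneg_right (f.norm_coe_le_norm x) (norm_nonneg _)

theorem coeFn_rho (f : X →ᵇ ℂ) (ξ : Lp E p μ) : rho E p μ f ξ =ᵐ[μ] fun x => f x • ξ x :=
  (memLp_mul f ξ).coeFn_toLp

theorem norm_rho_le (f : X →ᵇ ℂ) : ‖rho E p μ f‖ ≤ ‖f‖ :=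
  LinearMap.mkContinuous_norm_le _ (norm_nonneg _) _

variable (E p μ) in
/-- The elements of `VL_∞(X)`, viewed inside `𝔅(L^p(X; E))_∞` via the multiplication
representation. -/
def VLInfty : Set (SeqAlg (Lp E p μ →L[ℂ] Lp E p μ)) :=
  {F | ∃ (f : ℕ → X →ᵇ ℂ) (hf : IsVeryLipschitz f),
    F = SeqAlg.mk (fun n => rho E p μ (f n))
      (hf.1.imp fun _ hC n => (norm_rho_le (f n)).trans (hC n))}

/-- `T` is the block cutdown `θ_e(a) = ∑ j, e_j a e_j`, the sum converging in the strong operator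
topology. -/
def IsBlockCutdown {J : Type u} (e : J → X →ᵇ ℂ) (a T : Lp E p μ →L[ℂ] Lp E p μ) : Prop :=
  ∀ ξ : Lp E p μ, HasSum (fun j => (rho E p μ (e j) * a * rho E p μ (e j)) ξ) (T ξ)

/-- `B` is closed under block cutdowns: `θ_e(B) ⊆ B` for all families `e` as above. -/
def ClosedUnderBlockCutdowns (B : Set (Lp E p μ →L[ℂ] Lp E p μ)) : Prop :=
  ∀ (J : Type u) (e : J → X →ᵇ ℂ), IsCutdownFamily e →
    ∀ a ∈ B, ∀ T, IsBlockCutdown e a T → T ∈ B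

/-- `C_b(X) B C_b(X)`. -/
def cbMulCb (B : Set (Lp E p μ →L[ℂ] Lp E p μ)) : Set (Lp E p μ →L[ℂ] Lp E p μ) :=
  {T | ∃ f : X →ᵇ ℂ, ∃ b ∈ B, ∃ g : X →ᵇ ℂ, T = rho E p μ f * b * rho E p μ g}

/-- `a` has propagation at most `R`. -/
def HasPropagationAtMost (a : Lp E p μ →L[ℂ] Lp E p μ) (R : ℝ) : Prop :=
  ∀ f f' : X →ᵇ ℂ, ENNReal.ofReal R < setDist (tsupport f) (tsupport f') →
    rho E p μ f * a * rho E p μ f' = 0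

/-- `a` has `ε`-propagation at most `R`. -/
def HasEpsPropagationAtMost (a : Lp E p μ →L[ℂ] Lp E p μ) (ε R : ℝ) : Prop :=
  ∀ f f' : X →ᵇ ℂ, ‖f‖ ≤ 1 → ‖f'‖ ≤ 1 →
    ENNReal.ofReal R < setDist (tsupport f) (tsupport f') →
      ‖rho E p μ f * a * rho E p μ f'‖ < ε

/-- Quasi-local operators: finite `ε`-propagation for every `ε > 0`. -/
def IsQuasiLocal (a : Lp E p μ →L[ℂ] Lp E p μ) : Prop :=
  ∀ ε > 0, ∃ R ≥ 0, HasEpsPropagationAtMost a ε R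

/-- `Roe(X, B)`: the norm closure of the set of operators of finite propagation in `B`. -/
def Roe (B : Set (Lp E p μ →L[ℂ] Lp E p μ)) : Set (Lp E p μ →L[ℂ] Lp E p μ) :=
  closure {a | a ∈ B ∧ ∃ R ≥ 0, HasPropagationAtMost a R}

/-- `𝒦(X, B)`: the norm closure of `C_0(X) B C_0(X)`. -/
def KIdeal (B : Set (Lp E p μ →L[ℂ] Lp E p μ)) : Set (Lp E p μ →L[ℂ] Lp E p μ) :=
  closure {T | ∃ f : C₀(X, ℂ), ∃ b ∈ B, ∃ g : C₀(X, ℂ),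
    T = rho E p μ f.toBCF * b * rho E p μ g.toBCF}

end Operators

end RoeLike

set_option linter.unusedSectionVars false

namespace RoeLike

/-! ### The multiplication representation -/

section Representation

variable {X : Type u} [MetricSpace X] [MeasurableSpace X] [BorelSpace X]
  {E : Type v} [NormedAddCommGroup E] [NormedSpace ℂ E]
  {p : ℝ≥0∞} {μ : Measure X} [Fact (1 ≤ p)]

/-! Everything rests on one estimate. Since `p < ∞`, the `p`-th power of the norm is additive on
disjointly supported vectors, so `∑ l i * D i * r i` with orthogonal families `l` and `r` has norm
at most the supremum of `‖l i‖ ‖D i‖ ‖r i‖`, however many blocks there are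
(`norm_block_sum_apply_le`).

(ii) ⇒ (i): a quasi-local `b` almost commutes with every bounded function that varies little at a
suitable scale (`IsQuasiLocal.exists_modulus_of_norm_le`). Slice the range of such a function `h`
into short intervals. Quasi-locality controls the matrix coefficients between a slice and everything
away from its neighbours. On neighbouring slices `h` is nearly constant, and the block estimate sums
the rest in boundedly many groups.

(i) ⇒ (ii): if quasi-locality fails, Lipschitz bumps separating ever more distant pairs of supports
form a very Lipschitz sequence with large commutators.

(ii) ⇒ (iii): a Higson function, cut off slowly near a base point, has small variation at the scale
given by the modulus. What remains has compact support, and quasi-locality compresses its commutator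
between compactly supported cutoffs.

(iii) ⇒ (i): suppose a very Lipschitz sequence has commutators that do not tend to `0`. Its terms
can be localised in annuli arbitrarily far out (`exists_localized_commutator`) and glued into one
Higson function (`exists_isHigson_glue`), whose commutator would then fail to decay at infinity. The
annuli are separated so widely that they hardly interact under `b`; this too comes from (iii),
applied to compactly supported cutoffs.

(ii) ⇒ (iv): averaging over signs turns the modulus of `b` into a bound for `b ∑ ψᵢ² - ∑ ψᵢ b ψᵢ`
that does not depend on the number of disjoint bumps `ψᵢ` (`norm_sq_sub_block_le`). So one
`R`-decomposition replaces a block cutdown of `b`, up to a small error, by a sum of two block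
cutdowns along the finer family (`exists_adaptedCutdowns_split`). The operators at every stage are
block cutdowns of the original `b`, so the scales needed at all stages can be fixed beforehand from
the modulus of `b`; this is why the straight form of finite decomposition complexity suffices. At a
uniformly bounded stage the cutdowns have finite propagation. The converse holds because
quasi-locality passes to norm limits. -/

theorem rho_eq_of_ae {f : X →ᵇ ℂ} {ξ η : Lp E p μ} (h : ∀ᵐ x ∂μ, f x • ξ x = η x) :
    rho E p μ f ξ = η :=
  Lp.ext ((coeFn_rho f ξ).trans h)

theorem rho_one : rho E p μ 1 = 1 := by
  ext1 ξ
  exact rho_eq_of_ae (.of_forall fun x => by simp)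

theorem rho_mul (f g : X →ᵇ ℂ) : rho E p μ (f * g) = rho E p μ f * rho E p μ g := by
  ext1 ξ
  refine rho_eq_of_ae ?_
  filter_upwards [coeFn_rho f (rho E p μ g ξ), coeFn_rho g ξ] with x h₁ h₂
  rw [mul_apply_eq_comp, h₁, h₂, smul_smul, BoundedContinuousFunction.mul_apply]

theorem rho_add (f g : X →ᵇ ℂ) : rho E p μ (f + g) = rho E p μ f + rho E p μ g := by
  ext1 ξ
  refine rho_eq_of_ae ?_
  filter_upwards [coeFn_rho f ξ, coeFn_rho g ξ, Lp.coeFn_add (rho E p μ f ξ) (rho E p μ g ξ)]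
    with x h₁ h₂ h₃
  change _ = (rho E p μ f ξ + rho E p μ g ξ : Lp E p μ) x
  rw [h₃, Pi.add_apply, h₁, h₂, ← add_smul, BoundedContinuousFunction.add_apply]

theorem rho_smul (c : ℂ) (f : X →ᵇ ℂ) : rho E p μ (c • f) = c • rho E p μ f := by
  ext1 ξ
  refine rho_eq_of_ae ?_
  filter_upwards [coeFn_rho f ξ, Lp.coeFn_smul c (rho E p μ f ξ)] with x h₁ h₂
  change _ = (c • rho E p μ f ξ : Lp E p μ) x
  rw [h₂, Pi.smul_apply, h₁, smul_smul]
  rfl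

variable (E p μ) in
/-- The multiplication representation as a linear map. -/
noncomputable def rhoLin : (X →ᵇ ℂ) →ₗ[ℂ] (Lp E p μ →L[ℂ] Lp E p μ) where
  toFun := rho E p μ
  map_add' := rho_add
  map_smul' := rho_smul

theorem rho_zero : rho E p μ (0 : X →ᵇ ℂ) = 0 := map_zero (rhoLin E p μ)

theorem rho_sub (f g : X →ᵇ ℂ) : rho E p μ (f - g) = rho E p μ f - rho E p μ g :=
  map_sub (rhoLin E p μ) f g

theorem rho_sum {ι : Type*} (s : Finset ι) (f : ι → X →ᵇ ℂ) :
    rho E p μ (∑ i ∈ s, f i) = ∑ i ∈ s, rho E p μ (f i) :=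
  map_sum (rhoLin E p μ) f s

theorem rho_comm (f g : X →ᵇ ℂ) : rho E p μ f * rho E p μ g = rho E p μ g * rho E p μ f := by
  rw [← rho_mul, ← rho_mul, mul_comm]

theorem norm_rho_apply_le (f : X →ᵇ ℂ) {C : ℝ} (hf : ‖f‖ ≤ C) (ξ : Lp E p μ) :
    ‖rho E p μ f ξ‖ ≤ C * ‖ξ‖ :=
  (rho E p μ f).le_of_opNorm_le ((norm_rho_le f).trans hf) ξ

theorem norm_rho_mul_le (f : X →ᵇ ℂ) {C : ℝ} (hf : ‖f‖ ≤ C) (a : Lp E p μ →L[ℂ] Lp E p μ) :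
    ‖rho E p μ f * a‖ ≤ C * ‖a‖ :=
  (norm_mul_le _ _).trans (by gcongr; exact (norm_rho_le f).trans hf)

theorem norm_mul_rho_le (f : X →ᵇ ℂ) {C : ℝ} (hf : ‖f‖ ≤ C) (a : Lp E p μ →L[ℂ] Lp E p μ) :
    ‖a * rho E p μ f‖ ≤ ‖a‖ * C :=
  (norm_mul_le _ _).trans (by gcongr; exact (norm_rho_le f).trans hf)

end Representation

/-! ### Disjointly supported vectors and block sums -/

section BlockSums

variable {X : Type u} [MetricSpace X] [MeasurableSpace X] [BorelSpace X]
  {E : Type v} [NormedAddCommGroup E] [NormedSpace ℂ E]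
  {p : ℝ≥0∞} {μ : Measure X} [Fact (1 ≤ p)]

theorem toReal_exponent_pos (hp : p ≠ ∞) : 0 < p.toReal :=
  ENNReal.toReal_pos (zero_lt_one.trans_le Fact.out).ne' hp

theorem enorm_rpow_eq_lintegral (hp : p ≠ ∞) (ξ : Lp E p μ) :
    ‖ξ‖ₑ ^ p.toReal = ∫⁻ x, ‖ξ x‖ₑ ^ p.toReal ∂μ := by
  rw [Lp.enorm_def, eLpNorm_eq_lintegral_rpow_enorm_toReal (zero_lt_one.trans_le Fact.out).ne' hp,
    ← ENNReal.rpow_mul, one_div, inv_mul_cancel₀ (toReal_exponent_pos hp).ne', ENNReal.rpow_one]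

/-- The integrals defining the `p`-th powers split pointwise. This is the geometric property of
`L^p` from which all block estimates follow. -/
theorem norm_rpow_add_of_disjoint (hp : p ≠ ∞) {ξ η : Lp E p μ}
    (h : ∀ᵐ x ∂μ, ξ x = 0 ∨ η x = 0) :
    ‖ξ + η‖ ^ p.toReal = ‖ξ‖ ^ p.toReal + ‖η‖ ^ p.toReal := by
  have hpos := toReal_exponent_pos hp
  have key : ‖ξ + η‖ₑ ^ p.toReal = ‖ξ‖ₑ ^ p.toReal + ‖η‖ₑ ^ p.toReal := by
    rw [enorm_rpow_eq_lintegral hp, enorm_rpow_eq_lintegral hp, enorm_rpow_eq_lintegral hp,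
      ← lintegral_add_left' ((Lp.aestronglyMeasurable ξ).enorm.pow_const _)]
    refine lintegral_congr_ae ?_
    filter_upwards [h, Lp.coeFn_add ξ η] with x hx hadd
    rw [hadd, Pi.add_apply]
    rcases hx with hx | hx <;> simp [hx, hpos]
  have := congrArg ENNReal.toReal key
  rwa [ENNReal.toReal_add (by simp [hpos.le]) (by simp [hpos.le]), ← ENNReal.toReal_rpow,
    ← ENNReal.toReal_rpow, ← ENNReal.toReal_rpow, toReal_enorm, toReal_enorm, toReal_enorm] at this

variable {ι : Type*} {l r : ι → X →ᵇ ℂ}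

theorem norm_rpow_sum_rho (hp : p ≠ ∞) (hl : Pairwise fun i j => l i * l j = 0)
    (ζ : ι → Lp E p μ) (s : Finset ι) :
    ‖∑ i ∈ s, rho E p μ (l i) (ζ i)‖ ^ p.toReal =
      ∑ i ∈ s, ‖rho E p μ (l i) (ζ i)‖ ^ p.toReal := by
  classical
  induction s using Finset.induction_on with
  | empty => simp [(toReal_exponent_pos hp).ne']
  | insert a s ha ih =>
    rw [Finset.sum_insert ha, Finset.sum_insert ha, ← ih]
    refine norm_rpow_add_of_disjoint hp ?_
    have hsum : ∀ᵐ x ∂μ, (∑ i ∈ s, rho E p μ (l i) (ζ i) : Lp E p μ) x =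
        ∑ i ∈ s, l i x • ζ i x := by
      clear ih ha
      induction s using Finset.induction_on with
      | empty =>
        filter_upwards [Lp.coeFn_zero E p μ] with x hx
        rw [Finset.sum_empty, hx, Finset.sum_empty, Pi.zero_apply]
      | insert b t hb ih' =>
        rw [Finset.sum_insert hb]
        filter_upwards [ih', coeFn_rho (l b) (ζ b), Lp.coeFn_add (rho E p μ (l b) (ζ b))
          (∑ i ∈ t, rho E p μ (l i) (ζ i))] with x h₁ h₂ h₃
        rw [h₃, Pi.add_apply, h₁, h₂, Finset.sum_insert hb]
    filter_upwards [coeFn_rho (l a) (ζ a), hsum] with x h₁ h₂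
    rw [h₁, h₂]
    by_cases hx : l a x = 0
    · exact .inl (by rw [hx, zero_smul])
    · refine .inr (Finset.sum_eq_zero fun i hi => ?_)
      have h := DFunLike.congr_fun (hl (show a ≠ i by rintro rfl; exact ha hi)) x
      simp only [BoundedContinuousFunction.mul_apply, BoundedContinuousFunction.coe_zero,
        Pi.zero_apply, mul_eq_zero, hx, false_or] at h
      rw [h, zero_smul]

theorem norm_sum_le_of_pairwise (hl : Pairwise fun i j => l i * l j = 0) {C : ℝ} (hC : 0 ≤ C)
    (h : ∀ i, ‖l i‖ ≤ C) (s : Finset ι) : ‖∑ i ∈ s, l i‖ ≤ C := by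
  refine (BoundedContinuousFunction.norm_le hC).2 fun x => ?_
  rw [BoundedContinuousFunction.coe_sum, Finset.sum_apply]
  by_cases hx : ∃ i ∈ s, l i x ≠ 0
  · obtain ⟨i, hi, hix⟩ := hx
    rw [Finset.sum_eq_single_of_mem i hi]
    · exact ((l i).norm_coe_le_norm x).trans (h i)
    · intro j _ hj
      have h := DFunLike.congr_fun (hl hj.symm) x
      simpa [hix] using h
  · push Not at hx
    rw [Finset.sum_eq_zero hx, norm_zero]
    exact hC

theorem sum_norm_rpow_rho_le (hp : p ≠ ∞) (hr : Pairwise fun i j => r i * r j = 0) {β : ℝ}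
    (hβ : 0 ≤ β) (hrβ : ∀ i, ‖r i‖ ≤ β) (ξ : Lp E p μ) (s : Finset ι) :
    ∑ i ∈ s, ‖rho E p μ (r i) ξ‖ ^ p.toReal ≤ (β * ‖ξ‖) ^ p.toReal := by
  rw [← norm_rpow_sum_rho hp hr (fun _ => ξ)]
  refine Real.rpow_le_rpow (norm_nonneg _) ?_ (toReal_exponent_pos hp).le
  rw [← _root_.sum_apply, ← rho_sum]
  exact norm_rho_apply_le _ (norm_sum_le_of_pairwise hr hβ hrβ s) ξ

/-- Keeping the sum of the `‖r i ξ‖ ^ p` on the right makes this serve twice: bounding that sum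
gives the norm estimate, and its convergence gives the Cauchy criterion for the block sum. -/
theorem norm_rpow_block_sum_le (hp : p ≠ ∞) (hl : Pairwise fun i j => l i * l j = 0)
    {α c : ℝ} (hα : 0 ≤ α) (hc : 0 ≤ c) (hlα : ∀ i, ‖l i‖ ≤ α)
    {D : ι → Lp E p μ →L[ℂ] Lp E p μ} (hD : ∀ i, ‖D i‖ ≤ c) (ξ : Lp E p μ) (s : Finset ι) :
    ‖∑ i ∈ s, (rho E p μ (l i) * D i * rho E p μ (r i)) ξ‖ ^ p.toReal ≤
      (α * c) ^ p.toReal * ∑ i ∈ s, ‖rho E p μ (r i) ξ‖ ^ p.toReal := by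
  have h := norm_rpow_sum_rho hp hl (fun i => D i (rho E p μ (r i) ξ)) s
  simp only [mul_apply_eq_comp]
  rw [h, Finset.mul_sum]
  refine Finset.sum_le_sum fun i _ => ?_
  rw [← Real.mul_rpow (by positivity) (norm_nonneg _), mul_assoc]
  refine Real.rpow_le_rpow (norm_nonneg _) ?_ (toReal_exponent_pos hp).le
  exact (norm_rho_apply_le _ (hlα i) _).trans (by gcongr; exact (D i).le_of_opNorm_le (hD i) _)

theorem norm_block_sum_apply_le (hp : p ≠ ∞) (hl : Pairwise fun i j => l i * l j = 0)
    (hr : Pairwise fun i j => r i * r j = 0)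
    {α β c : ℝ} (hα : 0 ≤ α) (hβ : 0 ≤ β) (hc : 0 ≤ c) (hlα : ∀ i, ‖l i‖ ≤ α)
    (hrβ : ∀ i, ‖r i‖ ≤ β) {D : ι → Lp E p μ →L[ℂ] Lp E p μ} (hD : ∀ i, ‖D i‖ ≤ c)
    (ξ : Lp E p μ) (s : Finset ι) :
    ‖∑ i ∈ s, (rho E p μ (l i) * D i * rho E p μ (r i)) ξ‖ ≤ α * c * β * ‖ξ‖ := by
  have hpos := toReal_exponent_pos hp
  refine (Real.rpow_le_rpow_iff (norm_nonneg _) (by positivity) hpos).1 ?_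
  refine (norm_rpow_block_sum_le hp hl hα hc hlα hD ξ s).trans ?_
  rw [mul_assoc (α * c), Real.mul_rpow (x := α * c) (by positivity) (by positivity)]
  exact mul_le_mul_of_nonneg_left (sum_norm_rpow_rho_le hp hr hβ hrβ ξ s) (by positivity)

theorem summable_block_sum [CompleteSpace E] (hp : p ≠ ∞)
    (hl : Pairwise fun i j => l i * l j = 0) (hr : Pairwise fun i j => r i * r j = 0)
    {α β c : ℝ} (hα : 0 ≤ α) (hβ : 0 ≤ β) (hc : 0 ≤ c) (hlα : ∀ i, ‖l i‖ ≤ α)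
    (hrβ : ∀ i, ‖r i‖ ≤ β) {D : ι → Lp E p μ →L[ℂ] Lp E p μ} (hD : ∀ i, ‖D i‖ ≤ c)
    (ξ : Lp E p μ) :
    Summable fun i => (rho E p μ (l i) * D i * rho E p μ (r i)) ξ := by
  have hpos := toReal_exponent_pos hp
  have hs : Summable fun i => (α * c) ^ p.toReal * ‖rho E p μ (r i) ξ‖ ^ p.toReal :=
    (summable_of_sum_le (fun i => by positivity)
      (sum_norm_rpow_rho_le hp hr hβ hrβ ξ)).mul_left _
  rw [summable_iff_vanishing_norm] at hs ⊢
  intro ε hε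
  obtain ⟨s, hs⟩ := hs (ε ^ p.toReal) (by positivity)
  refine ⟨s, fun t ht => (Real.rpow_lt_rpow_iff (norm_nonneg _) hε.le hpos).1 ?_⟩
  refine (norm_rpow_block_sum_le hp hl hα hc hlα hD ξ t).trans_lt ?_
  rw [Finset.mul_sum]
  exact (le_abs_self _).trans_lt (hs t ht)

theorem norm_le_of_hasSum_block [CompleteSpace E] (hp : p ≠ ∞)
    (hl : Pairwise fun i j => l i * l j = 0) (hr : Pairwise fun i j => r i * r j = 0)
    {α β c : ℝ} (hα : 0 ≤ α) (hβ : 0 ≤ β) (hc : 0 ≤ c) (hlα : ∀ i, ‖l i‖ ≤ α)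
    (hrβ : ∀ i, ‖r i‖ ≤ β) {D : ι → Lp E p μ →L[ℂ] Lp E p μ} (hD : ∀ i, ‖D i‖ ≤ c)
    {ξ η : Lp E p μ}
    (h : HasSum (fun i => (rho E p μ (l i) * D i * rho E p μ (r i)) ξ) η) :
    ‖η‖ ≤ α * c * β * ‖ξ‖ :=
  le_of_tendsto h.norm
    (.of_forall fun s => norm_block_sum_apply_le hp hl hr hα hβ hc hlα hrβ hD ξ s)

/-- The block cutdown of an operator along an orthogonal family of contractions exists. -/
theorem exists_isBlockCutdown [CompleteSpace E] (hp : p ≠ ∞) {J : Type u} {e : J → X →ᵇ ℂ}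
    (he : Pairwise fun i j => e i * e j = 0) (he1 : ∀ i, ‖e i‖ ≤ 1)
    (a : Lp E p μ →L[ℂ] Lp E p μ) : ∃ T, IsBlockCutdown e a T := by
  have hs := summable_block_sum hp he he zero_le_one zero_le_one (norm_nonneg a) he1 he1
    (fun _ => le_rfl)
  refine ⟨LinearMap.mkContinuous
    { toFun := fun ξ => ∑' j, (rho E p μ (e j) * a * rho E p μ (e j)) ξ
      map_add' := fun ξ η => by
        simp only [map_add]
        exact (hs ξ).tsum_add (hs η)
      map_smul' := fun c ξ => by
        simp only [map_smul, RingHom.id_apply]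
        exact (hs ξ).tsum_const_smul c } (1 * ‖a‖ * 1)
    fun ξ => norm_le_of_hasSum_block hp he he zero_le_one zero_le_one (norm_nonneg a) he1 he1
      (fun _ => le_rfl) (hs ξ).hasSum, fun ξ => (hs ξ).hasSum⟩

end BlockSums

/-! ### Bump functions -/

section Bump

variable {X : Type u} [MetricSpace X]

/-- A real bounded continuous function, regarded as a complex one. -/
noncomputable def toC (f : X →ᵇ ℝ) : X →ᵇ ℂ :=
  f.comp Complex.ofReal Complex.isometry_ofReal.lipschitz

@[simp] theorem toC_apply (f : X →ᵇ ℝ) (x : X) : toC f x = (f x : ℂ) := rfl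

theorem toC_mul (f g : X →ᵇ ℝ) : toC (f * g) = toC f * toC g := by ext x; simp

theorem toC_add (f g : X →ᵇ ℝ) : toC (f + g) = toC f + toC g := by ext x; simp

theorem toC_sub (f g : X →ᵇ ℝ) : toC (f - g) = toC f - toC g := by ext x; simp

theorem toC_one : toC (1 : X →ᵇ ℝ) = 1 := by ext x; simp

theorem norm_toC_le {f : X →ᵇ ℝ} {C : ℝ} (hC : 0 ≤ C) (h : ∀ x, |f x| ≤ C) : ‖toC f‖ ≤ C :=
  (BoundedContinuousFunction.norm_le hC).2 fun x => by simpa using h x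

theorem lipschitzWith_toC {f : X →ᵇ ℝ} {L : ℝ≥0} (h : LipschitzWith L f) :
    LipschitzWith L (toC f) := by
  have h2 := Complex.isometry_ofReal.lipschitz.comp h
  rw [one_mul] at h2
  exact h2

/-- The function `u` truncated to take values in `[0, 1]`. -/
noncomputable def clamp (u : X → ℝ) (hu : Continuous u) : X →ᵇ ℝ :=
  BoundedContinuousFunction.ofNormedAddCommGroup (fun x => max 0 (min 1 (u x)))
    (continuous_const.max (continuous_const.min hu)) 1 fun x => by
      rw [Real.norm_eq_abs, abs_of_nonneg (le_max_left _ _)]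
      exact max_le zero_le_one (min_le_left _ _)

@[simp] theorem clamp_apply (u : X → ℝ) (hu : Continuous u) (x : X) :
    clamp u hu x = max 0 (min 1 (u x)) := rfl

theorem clamp_nonneg (u : X → ℝ) (hu : Continuous u) (x : X) : 0 ≤ clamp u hu x :=
  le_max_left _ _

theorem clamp_le_one (u : X → ℝ) (hu : Continuous u) (x : X) : clamp u hu x ≤ 1 :=
  max_le zero_le_one (min_le_left _ _)

theorem exists_bump (S : Set X) (t : ℝ) {L : ℝ≥0} (hL : 0 < L) :
    ∃ φ : X →ᵇ ℝ, (∀ x, 0 ≤ φ x) ∧ (∀ x, φ x ≤ 1) ∧ LipschitzWith L φ ∧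
      (∀ x, ∀ y ∈ S, dist x y ≤ t → φ x = 1) ∧
      ∀ x, φ x ≠ 0 → ∃ y ∈ S, dist x y < t + 1 / L := by
  rcases S.eq_empty_or_nonempty with rfl | hS
  -- `Metric.infDist` to the empty set is `0`, so the formula used below would not vanish anywhere
  -- it should.
  · refine ⟨0, fun x => le_rfl, fun x => zero_le_one, ?_, by simp, by simp⟩
    exact LipschitzWith.const' 0
  have hlip : LipschitzWith L fun x : X => 1 - L * (Metric.infDist x S - t) := by
    refine LipschitzWith.of_dist_le_mul fun x y => ?_
    have h := (Metric.lipschitz_infDist_pt S).dist_le_mul x y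
    rw [Real.dist_eq] at h ⊢
    rw [NNReal.coe_one, one_mul] at h
    rw [show 1 - (L : ℝ) * (Metric.infDist x S - t) - (1 - L * (Metric.infDist y S - t)) =
      L * -(Metric.infDist x S - Metric.infDist y S) by ring, abs_mul, abs_neg,
      abs_of_nonneg L.coe_nonneg]
    gcongr
  have hL' : (0 : ℝ) < L := hL
  refine ⟨clamp _ hlip.continuous, clamp_nonneg _ _, clamp_le_one _ _,
    (hlip.const_min 1).const_max 0, fun x y hy hxy => ?_, fun x hx => ?_⟩
  · have h := (Metric.infDist_le_dist_of_mem hy).trans hxy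
    rw [clamp_apply, min_eq_left, max_eq_right zero_le_one]
    nlinarith
  · have h : 0 < 1 - L * (Metric.infDist x S - t) := by
      by_contra! h
      exact hx (by rw [clamp_apply, max_eq_left]; exact (min_le_right _ _).trans h)
    refine (Metric.infDist_lt_iff hS).1 ?_
    rw [← sub_lt_iff_lt_add', lt_div_iff₀ hL']
    linarith

theorem lt_setDist_of_forall_le {S T : Set X} {R R' : ℝ} (hR : 0 ≤ R) (h : R < R')
    (hST : ∀ x ∈ S, ∀ y ∈ T, R' ≤ dist x y) : ENNReal.ofReal R < setDist S T := by
  refine ((ENNReal.ofReal_lt_ofReal_iff (hR.trans_lt h)).2 h).trans_le ?_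
  refine le_iInf₂ fun x hx => le_iInf₂ fun y hy => ?_
  rw [edist_dist]
  exact ENNReal.ofReal_le_ofReal (hST x hx y hy)

theorem lt_dist_of_lt_setDist {S T : Set X} {R : ℝ} (h : ENNReal.ofReal R < setDist S T) {x y : X}
    (hx : x ∈ S) (hy : y ∈ T) : R < dist x y := by
  have h2 : setDist S T ≤ edist x y := (iInf₂_le x hx).trans (iInf₂_le y hy)
  have h3 := h.trans_le h2
  rw [edist_dist] at h3
  exact lt_of_not_ge fun hle => h3.not_ge (ENNReal.ofReal_le_ofReal hle)

/-- `e` is an `L`-Lipschitz cutoff function which is `1` on the ball of radius `r` and vanishes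
outside the ball of radius `s` around `x₀`. -/
structure IsCutoff (x₀ : X) (r s : ℝ) (L : ℝ≥0) (e : X →ᵇ ℂ) : Prop where
  norm_le : ‖e‖ ≤ 1
  norm_one_sub_le : ‖1 - e‖ ≤ 1
  lipschitz : LipschitzWith L e
  eq_one : ∀ x, dist x x₀ ≤ r → e x = 1
  eq_zero : ∀ x, s ≤ dist x x₀ → e x = 0

theorem exists_isCutoff (x₀ : X) (r : ℝ) {L : ℝ≥0} (hL : 0 < L) :
    ∃ e : X →ᵇ ℂ, IsCutoff x₀ r (r + 1 / L) L e := by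
  obtain ⟨φ, h0, h1, hlip, hone, hsupp⟩ := exists_bump {x₀} r hL
  refine ⟨toC φ, norm_toC_le zero_le_one fun x => ?_, ?_, lipschitzWith_toC hlip,
    fun x hx => ?_, fun x hx => ?_⟩
  · rw [abs_of_nonneg (h0 x)]
    exact h1 x
  · rw [← toC_one, ← toC_sub]
    refine norm_toC_le zero_le_one fun x => ?_
    have := h0 x
    have := h1 x
    rw [abs_le]
    constructor <;> simp <;> linarith
  · rw [toC_apply, hone x x₀ rfl hx, Complex.ofReal_one]
  · by_contra hne
    obtain ⟨y, rfl, hy⟩ := hsupp x (by simpa using hne)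
    linarith

theorem IsCutoff.exists_zeroAtInfty [ProperSpace X] {x₀ : X} {r s : ℝ} {L : ℝ≥0} {e : X →ᵇ ℂ}
    (he : IsCutoff x₀ r s L e) : ∃ c : C₀(X, ℂ), c.toBCF = e := by
  have hc : HasCompactSupport e := by
    refine HasCompactSupport.intro (isCompact_closedBall x₀ s) fun x hx => he.eq_zero x ?_
    rw [Metric.mem_closedBall, not_le] at hx
    exact hx.le
  exact ⟨⟨e.toContinuousMap, hc.is_zero_at_infty⟩, by ext x; rfl⟩

end Bump

/-! ### Strong convergence of cutoff functions to the identity. -/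

section Strong

variable {X : Type u} [MetricSpace X] [MeasurableSpace X] [BorelSpace X]
  {E : Type v} [NormedAddCommGroup E] [NormedSpace ℂ E]
  {p : ℝ≥0∞} {μ : Measure X} [Fact (1 ≤ p)]

/-- Dominated convergence for `‖(1 - e m) ξ‖ ^ p`. This allows operators to be tested on vectors
supported in balls. -/
theorem tendsto_rho_cutoff (hp : p ≠ ∞) (x₀ : X) {e : ℕ → X →ᵇ ℂ} (he : ∀ m, ‖1 - e m‖ ≤ 1)
    (he1 : ∀ (m : ℕ) x, dist x x₀ ≤ m → e m x = 1) (ξ : Lp E p μ) :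
    Tendsto (fun m => rho E p μ (e m) ξ) atTop (𝓝 ξ) := by
  have hpos := toReal_exponent_pos hp
  have hlim : Tendsto (fun m => ∫⁻ x, ‖rho E p μ (1 - e m) ξ x‖ₑ ^ p.toReal ∂μ) atTop
      (𝓝 (∫⁻ _, 0 ∂μ)) := by
    refine tendsto_lintegral_of_dominated_convergence' (fun x => ‖ξ x‖ₑ ^ p.toReal)
      (fun m => (Lp.aestronglyMeasurable _).enorm.pow_const _) (fun m => ?_) ?_ ?_
    · filter_upwards [coeFn_rho (1 - e m) ξ] with x hx
      rw [hx]
      refine ENNReal.rpow_le_rpow ?_ hpos.le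
      rw [enorm_le_iff_norm_le, norm_smul]
      exact mul_le_of_le_one_left (norm_nonneg _)
        (((1 - e m).norm_coe_le_norm x).trans (he m))
    · rw [← enorm_rpow_eq_lintegral hp]
      simp [hpos.le]
    · have h : ∀ᵐ x ∂μ, ∀ m, rho E p μ (1 - e m) ξ x = (1 - e m) x • ξ x :=
        ae_all_iff.2 fun m => coeFn_rho _ _
      filter_upwards [h] with x hx
      refine tendsto_const_nhds.congr' ?_
      filter_upwards [eventually_ge_atTop ⌈dist x x₀⌉₊] with m hm
      rw [hx m]
      simp [he1 m x ((Nat.le_ceil _).trans (by exact_mod_cast hm)), hpos]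
  simp only [← enorm_rpow_eq_lintegral hp, lintegral_zero] at hlim
  have h2 := hlim.ennrpow_const (1 / p.toReal)
  simp only [← ENNReal.rpow_mul, mul_one_div_cancel hpos.ne', ENNReal.rpow_one,
    ENNReal.zero_rpow_of_pos (one_div_pos.2 hpos)] at h2
  have h3 : Tendsto (fun m => rho E p μ (1 - e m) ξ) atTop (𝓝 0) :=
    tendsto_zero_iff_enorm_tendsto_zero.2 h2
  have h4 := h3.const_sub ξ
  rw [sub_zero] at h4
  refine h4.congr fun m => ?_
  rw [rho_sub, rho_one]
  change ξ - (ξ - rho E p μ (e m) ξ) = _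
  abel

end Strong

/-! ### Quasi-local operators almost commute with functions of small variation -/

section Modulus

variable {X : Type u} [MetricSpace X] [MeasurableSpace X] [BorelSpace X]
  {E : Type v} [NormedAddCommGroup E] [NormedSpace ℂ E]
  {p : ℝ≥0∞} {μ : Measure X} [Fact (1 ≤ p)]

/-- A band sum splits into `k` block sums. -/
theorem norm_band_sum_le (hp : p ≠ ∞) {k : ℕ} (hk : 0 < k) {l r : ℕ → X →ᵇ ℂ}
    (hl : ∀ i j, i % k = j % k → i ≠ j → l i * l j = 0)
    (hr : ∀ i j, i % k = j % k → i ≠ j → r i * r j = 0)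
    {α β : ℝ} (hα : 0 ≤ α) (hβ : 0 ≤ β) (hlα : ∀ i, ‖l i‖ ≤ α) (hrβ : ∀ i, ‖r i‖ ≤ β)
    (b : Lp E p μ →L[ℂ] Lp E p μ) (n : ℕ) :
    ‖∑ i ∈ Finset.range n, rho E p μ (l i) * b * rho E p μ (r i)‖ ≤ k * (α * ‖b‖ * β) := by
  -- Blanking all indices outside one residue class mod `k` makes each family orthogonal.
  let l' : ℕ → ℕ → X →ᵇ ℂ := fun s i => if i % k = s then l i else 0
  let r' : ℕ → ℕ → X →ᵇ ℂ := fun s i => if i % k = s then r i else 0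
  have orth : ∀ f : ℕ → X →ᵇ ℂ, (∀ i j, i % k = j % k → i ≠ j → f i * f j = 0) → ∀ s,
      Pairwise fun i j => (if i % k = s then f i else 0) * (if j % k = s then f j else 0) = 0 := by
    intro f hf s i j hij
    by_cases hi : i % k = s <;> by_cases hj : j % k = s <;> simp only [hi, hj, if_true, if_false,
      mul_zero, zero_mul]
    exact hf i j (hi.trans hj.symm) hij
  have bound : ∀ f : ℕ → X →ᵇ ℂ, ∀ γ : ℝ, 0 ≤ γ → (∀ i, ‖f i‖ ≤ γ) → ∀ s i,
      ‖(if i % k = s then f i else 0)‖ ≤ γ := by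
    intro f γ hγ hf s i
    split_ifs
    · exact hf i
    · simpa using hγ
  have hsplit : ∑ i ∈ Finset.range n, rho E p μ (l i) * b * rho E p μ (r i) =
      ∑ s ∈ Finset.range k, ∑ i ∈ Finset.range n,
        rho E p μ (l' s i) * b * rho E p μ (r' s i) := by
    rw [Finset.sum_comm]
    refine Finset.sum_congr rfl fun i _ => ?_
    rw [Finset.sum_eq_single_of_mem (i % k) (Finset.mem_range.2 (Nat.mod_lt i hk))]
    · simp [l', r']
    · intro s _ hs
      simp [l', r', hs.symm, rho_zero]
  rw [hsplit]
  refine (norm_sum_le_of_le (f := fun s => ∑ i ∈ Finset.range n,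
        rho E p μ (l' s i) * b * rho E p μ (r' s i)) _ (n := fun _ => α * ‖b‖ * β)
    fun s _ => ?_).trans (by simp)
  refine ContinuousLinearMap.opNorm_le_bound _ (by positivity) fun ξ => ?_
  rw [_root_.sum_apply]
  exact norm_block_sum_apply_le hp (orth l hl s) (orth r hr s) hα hβ (norm_nonneg b)
    (bound l α hα hlα s) (bound r β hβ hrβ s) (fun _ => le_rfl) ξ _

theorem norm_commutator_le (b : Lp E p μ →L[ℂ] Lp E p μ) (h : X →ᵇ ℂ) :
    ‖b * rho E p μ h - rho E p μ h * b‖ ≤ 2 * ‖b‖ * ‖h‖ := by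
  have h1 := norm_mul_rho_le h le_rfl b
  have h2 := norm_rho_mul_le h le_rfl b
  linarith [norm_sub_le (b * rho E p μ h) (rho E p μ h * b)]

theorem tsupport_subset_of_continuous {f : X →ᵇ ℂ} {u : X → ℝ} (hu : Continuous u) {s : Set ℝ}
    (hs : IsClosed s) (h : ∀ x, f x ≠ 0 → u x ∈ s) : ∀ x ∈ tsupport f, u x ∈ s :=
  fun _ hx => closure_minimal (fun y hy => h y hy) (hs.preimage hu) hx

/-- Let `e i` be a partition of unity along the level sets of `h`, at spacing `1 / N`, and let `q i`
be a wider cutoff that is `1` near `e i`. Since `h` may be replaced by `g i = h - const` inside a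
commutator, `[b, h]` is the sum of the far terms `(1 - q i) [b, h] (e i)` and the near terms `q i b
(g i e i) - (g i q i) b (e i)`. Quasi-locality makes each of the `2N + 1` far terms tiny. In the
near terms `g i` has size `O(1 / N)`, and their band sums are controlled by block estimates
independently of the number of slices. -/
theorem IsQuasiLocal.exists_modulus_real (hp : p ≠ ∞) {b : Lp E p μ →L[ℂ] Lp E p μ}
    (hb : IsQuasiLocal b) {ε : ℝ} (hε : 0 < ε) :
    ∃ R > 0, ∃ δ > 0, ∀ h : X →ᵇ ℝ, (∀ x, |h x| ≤ 1) →
      (∀ x y, dist x y ≤ R → |h x - h y| < δ) →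
      ‖b * rho E p μ (toC h) - rho E p μ (toC h) * b‖ ≤ ε := by
  -- The near terms will total at most `6 * (1 + 3) * ‖b‖ / N = 24 ‖b‖ / N`, which must not exceed
  -- `ε / 2`.
  obtain ⟨N, hN⟩ := exists_nat_gt (48 * ‖b‖ / ε)
  have hN0 : (0 : ℝ) < N := lt_of_le_of_lt (by positivity) hN
  rw [div_lt_iff₀ hε] at hN
  set η : ℝ := ε / (4 * (2 * N + 1)) with hη
  obtain ⟨R, hR0, hR⟩ := hb η (by positivity)
  refine ⟨R + 1, by linarith, 1 / N, by positivity, fun h h1 hvar => ?_⟩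
  -- The values of `u` lie in `[1, 2N + 1]`, so the ramps `c 0` and `c (2N + 1)` are constantly `1`
  -- and `0`, and the differences `e i` telescope to `1`.
  let u : X → ℝ := fun x => N * h x + N + 1
  have hu : Continuous u := by fun_prop
  let c : ℕ → X →ᵇ ℝ := fun i => clamp (fun x => u x - i) (by fun_prop)
  let e : ℕ → X →ᵇ ℝ := fun i => c i - c (i + 1)
  let q : ℕ → X →ᵇ ℝ := fun i => clamp (fun x => 3 - |u x - (i + 1)|) (by fun_prop)
  let g : ℕ → X →ᵇ ℝ := fun i => h - BoundedContinuousFunction.const X ((i - N : ℝ) / N)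
  have hc : ∀ i x, c i x = max 0 (min 1 (u x - i)) := fun i x => rfl
  have he : ∀ i x, e i x = max 0 (min 1 (u x - i)) - max 0 (min 1 (u x - (i + 1))) := by
    intro i x
    simp [e, hc]
  have hq : ∀ i x, q i x = max 0 (min 1 (3 - |u x - (i + 1)|)) := fun i x => rfl
  have hg : ∀ i x, N * g i x = u x - (i + 1) := by
    intro i x
    simp only [g, u, BoundedContinuousFunction.sub_apply, BoundedContinuousFunction.const_apply]
    field_simp
    ring
  have hu1 : ∀ x, 1 ≤ u x ∧ u x ≤ 2 * N + 1 := by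
    intro x
    have := abs_le.1 (h1 x)
    constructor <;> simp only [u] <;> nlinarith
  have he01 : ∀ i x, 0 ≤ e i x ∧ e i x ≤ 1 := by
    intro i x
    rw [he]
    constructor
    · rw [sub_nonneg]
      exact max_le_max le_rfl (min_le_min le_rfl (by linarith))
    · have h2 : max 0 (min 1 (u x - i)) ≤ (1 : ℝ) := max_le zero_le_one (min_le_left _ _)
      have h3 : 0 ≤ max 0 (min 1 (u x - (i + 1))) := le_max_left _ _
      linarith
  have he0 : ∀ i x, e i x ≠ 0 → |u x - (i + 1)| ≤ 1 := by
    intro i x hx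
    rw [he] at hx
    contrapose! hx
    rcases lt_abs.1 hx with h2 | h2
    · rw [min_eq_left (by linarith), min_eq_left (by linarith), sub_self]
    · rw [max_eq_left ((min_le_right _ _).trans (by linarith)),
        max_eq_left ((min_le_right _ _).trans (by linarith)), sub_self]
  have hq0 : ∀ i x, q i x ≠ 0 → |u x - (i + 1)| < 3 := by
    intro i x hx
    rw [hq] at hx
    contrapose! hx
    exact max_eq_left ((min_le_right _ _).trans (by linarith))
  have hq1 : ∀ i x, 1 - q i x ≠ 0 → 2 ≤ |u x - (i + 1)| := by
    intro i x hx
    rw [hq] at hx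
    contrapose! hx
    rw [min_eq_left (by linarith), max_eq_right zero_le_one, sub_self]
  have hsum : ∑ i ∈ Finset.range (2 * N + 1), toC (e i) = 1 := by
    ext x
    simp only [BoundedContinuousFunction.coe_sum, Finset.sum_apply, toC_apply]
    rw [← Complex.ofReal_sum]
    have : ∑ i ∈ Finset.range (2 * N + 1), e i x = c 0 x - c (2 * N + 1) x :=
      Finset.sum_range_sub' (fun i => c i x) _
    rw [this, hc, hc, min_eq_left (by have := hu1 x; push_cast; linarith),
      max_eq_right zero_le_one, max_eq_left]
    · simp
    · refine (min_le_right _ _).trans ?_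
      have := hu1 x
      push_cast
      linarith
  -- All functions involved live where `u` is within `3` of `i + 1`, an interval of length `6`;
  -- hence six residue classes.
  have hsep : ∀ (i j : ℕ) x, i % 6 = j % 6 → i ≠ j → |u x - (i + 1)| < 3 → |u x - (j + 1)| < 3 →
      False := by
    intro i j x hij hne hi hj
    rw [abs_lt] at hi hj
    have h2 : (i : ℝ) < j + 6 := by linarith
    have h3 : (j : ℝ) < i + 6 := by linarith
    have h2' : i < j + 6 := by exact_mod_cast h2
    have h3' : j < i + 6 := by exact_mod_cast h3
    omega
  have orth : ∀ f : ℕ → X →ᵇ ℝ, (∀ i x, f i x ≠ 0 → |u x - (i + 1)| < 3) →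
      ∀ i j, i % 6 = j % 6 → i ≠ j → toC (f i) * toC (f j) = 0 := by
    intro f hf i j hij hne
    ext x
    simp only [BoundedContinuousFunction.mul_apply, toC_apply, BoundedContinuousFunction.coe_zero,
      Pi.zero_apply, mul_eq_zero, Complex.ofReal_eq_zero]
    by_contra! hx
    exact hsep i j x hij hne (hf i x hx.1) (hf j x hx.2)
  have he3 : ∀ i x, e i x ≠ 0 → |u x - (i + 1)| < 3 := fun i x hx =>
    (he0 i x hx).trans_lt (by norm_num)
  have hne : ∀ i, ‖toC (e i)‖ ≤ 1 := fun i => norm_toC_le zero_le_one fun x =>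
    abs_le.2 ⟨by linarith [(he01 i x).1], (he01 i x).2⟩
  have hnq : ∀ i, ‖toC (q i)‖ ≤ 1 := fun i => norm_toC_le zero_le_one fun x =>
    abs_le.2 ⟨by linarith [show 0 ≤ q i x from clamp_nonneg _ _ x], clamp_le_one _ _ x⟩
  have hnq1 : ∀ i, ‖1 - toC (q i)‖ ≤ 1 := by
    intro i
    rw [← toC_one, ← toC_sub]
    refine norm_toC_le zero_le_one fun x => ?_
    have h2 : 0 ≤ q i x := clamp_nonneg _ _ x
    have h3 : q i x ≤ 1 := clamp_le_one _ _ x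
    rw [abs_le]
    constructor <;> simp <;> linarith
  have hgabs : ∀ i x, |g i x| = |u x - (i + 1)| / N := by
    intro i x
    rw [← hg, abs_mul, abs_of_pos hN0, mul_div_cancel_left₀ _ hN0.ne']
  have hnge : ∀ i, ‖toC (g i * e i)‖ ≤ 1 / N := fun i => norm_toC_le (by positivity) fun x => by
    rw [BoundedContinuousFunction.mul_apply, abs_mul, hgabs]
    by_cases hx : e i x = 0
    · rw [hx, abs_zero, mul_zero]
      positivity
    · rw [← mul_one (1 / (N : ℝ))]
      gcongr
      · exact he0 i x hx
      · exact abs_le.2 ⟨by linarith [(he01 i x).1], (he01 i x).2⟩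
  have hngq : ∀ i, ‖toC (g i * q i)‖ ≤ 3 / N := fun i => norm_toC_le (by positivity) fun x => by
    rw [BoundedContinuousFunction.mul_apply, abs_mul, hgabs]
    by_cases hx : q i x = 0
    · rw [hx, abs_zero, mul_zero]
      positivity
    · rw [← mul_one (3 / (N : ℝ))]
      gcongr
      · exact (hq0 i x hx).le
      · exact abs_le.2 ⟨by linarith [show 0 ≤ q i x from clamp_nonneg _ _ x], clamp_le_one _ _ x⟩
  have hge0 : ∀ i x, (g i * e i) x ≠ 0 → |u x - (i + 1)| < 3 := fun i x hx =>
    he3 i x (right_ne_zero_of_mul hx)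
  have hgq0 : ∀ i x, (g i * q i) x ≠ 0 → |u x - (i + 1)| < 3 := fun i x hx =>
    hq0 i x (right_ne_zero_of_mul hx)
  -- Between the two supports `u` changes by at least `1`, so `h` changes by at least `1 / N`; by
  -- the variation hypothesis they are more than `R + 1` apart.
  have hfar : ∀ i, ‖rho E p μ (1 - toC (q i)) * b * rho E p μ (toC (e i))‖ ≤ η := by
    intro i
    refine (hR _ _ (hnq1 i) (hne i) (lt_setDist_of_forall_le hR0 (lt_add_one R) ?_)).le
    intro x hx y hy
    have hx' := tsupport_subset_of_continuous (f := 1 - toC (q i)) (u := fun x => |u x - (i + 1)|)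
      (by fun_prop) (isClosed_Ici (a := 2)) (fun x hx => hq1 i x fun h0 => hx (by
        simp only [BoundedContinuousFunction.sub_apply, toC_apply]
        rw [BoundedContinuousFunction.coe_one, Pi.one_apply]
        exact_mod_cast h0)) x hx
    have hy' := tsupport_subset_of_continuous (f := toC (e i)) (u := fun x => |u x - (i + 1)|)
      (by fun_prop) (isClosed_Iic (a := 1)) (fun x hx => he0 i x fun h0 => hx (by simp [h0])) y hy
    simp only [Set.mem_Ici, Set.mem_Iic] at hx' hy'
    by_contra! hxy
    have h2 := hvar x y hxy.le
    have h3 : |u x - u y| < 1 := by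
      rw [show u x - u y = N * (h x - h y) by simp only [u]; ring, abs_mul, abs_of_pos hN0]
      calc (N : ℝ) * |h x - h y| < N * (1 / N) := by gcongr
        _ = 1 := by field_simp
    have h4 := abs_add_le (u x - u y) (u y - (i + 1))
    rw [show u x - u y + (u y - (i + 1)) = u x - (i + 1) by ring] at h4
    linarith
  set m : (X →ᵇ ℂ) → Lp E p μ →L[ℂ] Lp E p μ := rho E p μ with hm
  set T := b * m (toC h) - m (toC h) * b with hT
  have hT1 : T = ∑ i ∈ Finset.range (2 * N + 1), m (1 - toC (q i)) * T * m (toC (e i)) +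
      (∑ i ∈ Finset.range (2 * N + 1), m (toC (q i)) * b * m (toC (g i * e i)) -
        ∑ i ∈ Finset.range (2 * N + 1), m (toC (g i * q i)) * b * m (toC (e i))) := by
    rw [← Finset.sum_sub_distrib, ← Finset.sum_add_distrib]
    have h0 : T = ∑ i ∈ Finset.range (2 * N + 1), T * m (toC (e i)) := by
      rw [← Finset.mul_sum, hm, ← rho_sum, hsum, rho_one, mul_one]
    refine h0.trans (Finset.sum_congr rfl fun i _ => ?_)
    have hcon : toC (g i) = toC h - ((i - N : ℝ) / N : ℂ) • (1 : X →ᵇ ℂ) := by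
      ext x
      simp [g]
    rw [toC_mul, toC_mul, mul_comm (toC (g i)) (toC (q i))]
    simp only [hm, rho_mul, hcon, rho_sub, rho_one, hT, rho_smul, sub_mul, mul_sub, one_mul,
      mul_smul_comm, smul_mul_assoc, mul_one, mul_assoc]
    abel
  have hfar' : ∀ i, ‖m (1 - toC (q i)) * T * m (toC (e i))‖ ≤ 2 * η := by
    intro i
    have h2 : m (1 - toC (q i)) * T * m (toC (e i)) =
        m (1 - toC (q i)) * b * m (toC (e i)) * m (toC h) -
          m (toC h) * (m (1 - toC (q i)) * b * m (toC (e i))) := by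
      rw [hT, mul_sub, sub_mul]
      congr 1
      · simp only [mul_assoc, hm, rho_comm (toC h)]
      · simp only [← mul_assoc, hm, rho_comm (toC h)]
    have hh : ‖toC h‖ ≤ 1 := norm_toC_le zero_le_one h1
    have h3 := norm_mul_rho_le (toC h) hh (m (1 - toC (q i)) * b * m (toC (e i)))
    have h4 := norm_rho_mul_le (toC h) hh (m (1 - toC (q i)) * b * m (toC (e i)))
    rw [h2]
    have h5 := norm_sub_le (m (1 - toC (q i)) * b * m (toC (e i)) * m (toC h))
      (m (toC h) * (m (1 - toC (q i)) * b * m (toC (e i))))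
    linarith [hfar i]
  have hA : ‖∑ i ∈ Finset.range (2 * N + 1), m (1 - toC (q i)) * T * m (toC (e i))‖ ≤
      (2 * N + 1) * (2 * η) := by
    refine (norm_sum_le_of_le _ fun i _ => hfar' i).trans_eq ?_
    simp
  have hB := norm_band_sum_le hp (k := 6) (by norm_num) (orth q hq0) (orth _ hge0) zero_le_one
    (by positivity) hnq hnge b (2 * N + 1)
  have hC := norm_band_sum_le hp (k := 6) (by norm_num) (orth _ hgq0) (orth e he3)
    (by positivity) zero_le_one hngq hne b (2 * N + 1)
  have h24 : 24 * ‖b‖ / N ≤ ε / 2 := by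
    rw [div_le_iff₀ hN0]
    linarith
  have hη2 : (2 * N + 1) * (2 * η) = ε / 2 := by
    rw [hη]
    field_simp
    norm_num
  rw [hT1]
  refine (norm_add_le _ _).trans ?_
  have h5 := norm_sub_le (∑ i ∈ Finset.range (2 * N + 1), m (toC (q i)) * b * m (toC (g i * e i)))
    (∑ i ∈ Finset.range (2 * N + 1), m (toC (g i * q i)) * b * m (toC (e i)))
  have h6 : ((6 : ℕ) : ℝ) * (1 * ‖b‖ * (1 / N)) + (6 : ℕ) * (3 / N * ‖b‖ * 1) = 24 * ‖b‖ / N := by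
    push_cast
    ring
  linarith

theorem IsQuasiLocal.exists_modulus (hp : p ≠ ∞) {b : Lp E p μ →L[ℂ] Lp E p μ}
    (hb : IsQuasiLocal b) {ε : ℝ} (hε : 0 < ε) :
    ∃ R > 0, ∃ δ > 0, ∀ h : X →ᵇ ℂ, ‖h‖ ≤ 1 →
      (∀ x y, dist x y ≤ R → ‖h x - h y‖ < δ) →
      ‖b * rho E p μ h - rho E p μ h * b‖ ≤ ε := by
  obtain ⟨R, hR, δ, hδ, hmod⟩ := hb.exists_modulus_real hp (half_pos hε)
  refine ⟨R, hR, δ, hδ, fun h h1 hvar => ?_⟩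
  let hre : X →ᵇ ℝ := h.comp Complex.re Complex.reCLM.lipschitz
  let him : X →ᵇ ℝ := h.comp Complex.im Complex.imCLM.lipschitz
  have hdec : h = toC hre + Complex.I • toC him := by
    ext x
    change h x = ((h x).re : ℂ) + Complex.I * ((h x).im : ℂ)
    rw [mul_comm, Complex.re_add_im]
  have hr := hmod hre
    (fun x => (Complex.abs_re_le_norm _).trans ((h.norm_coe_le_norm x).trans h1))
    fun x y hxy => lt_of_le_of_lt (Complex.abs_re_le_norm (h x - h y)) (hvar x y hxy)
  have hi := hmod him
    (fun x => (Complex.abs_im_le_norm _).trans ((h.norm_coe_le_norm x).trans h1))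
    fun x y hxy => lt_of_le_of_lt (Complex.abs_im_le_norm (h x - h y)) (hvar x y hxy)
  have hcomm : b * rho E p μ h - rho E p μ h * b =
      (b * rho E p μ (toC hre) - rho E p μ (toC hre) * b) +
        Complex.I • (b * rho E p μ (toC him) - rho E p μ (toC him) * b) := by
    conv_lhs => rw [hdec]
    simp only [rho_add, rho_smul, mul_add, add_mul, mul_smul_comm, smul_mul_assoc, smul_sub]
    abel
  rw [hcomm]
  refine (norm_add_le _ _).trans ?_
  rw [norm_smul, Complex.norm_I, one_mul]
  linarith

theorem IsQuasiLocal.exists_modulus_of_norm_le (hp : p ≠ ∞) {b : Lp E p μ →L[ℂ] Lp E p μ}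
    (hb : IsQuasiLocal b) {D : ℝ} (hD : 0 < D) {ε : ℝ} (hε : 0 < ε) :
    ∃ R > 0, ∃ δ > 0, ∀ h : X →ᵇ ℂ, ‖h‖ ≤ D →
      (∀ x y, dist x y ≤ R → ‖h x - h y‖ < δ) →
      ‖b * rho E p μ h - rho E p μ h * b‖ ≤ ε := by
  obtain ⟨R, hR, δ, hδ, hmod⟩ := hb.exists_modulus hp (div_pos hε hD)
  have hDnorm : ‖((D : ℂ)⁻¹)‖ = D⁻¹ := by
    rw [norm_inv, Complex.norm_real, Real.norm_eq_abs, abs_of_pos hD]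
  refine ⟨R, hR, D * δ, by positivity, fun h h1 hvar => ?_⟩
  have key := hmod ((D : ℂ)⁻¹ • h) (by
      rw [norm_smul, hDnorm, inv_mul_le_one₀ hD]
      exact h1) fun x y hxy => by
        have h2 := hvar x y hxy
        change ‖(D : ℂ)⁻¹ * h x - (D : ℂ)⁻¹ * h y‖ < δ
        rw [← mul_sub, norm_mul, hDnorm, inv_mul_lt_iff₀ hD]
        exact h2
  rw [rho_smul, mul_smul_comm, smul_mul_assoc, ← smul_sub, norm_smul, hDnorm,
    inv_mul_le_iff₀ hD, mul_div_cancel₀ _ hD.ne'] at key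
  exact key

theorem IsQuasiLocal.exists_lipschitz_modulus (hp : p ≠ ∞) {b : Lp E p μ →L[ℂ] Lp E p μ}
    (hb : IsQuasiLocal b) {D : ℝ} (hD : 0 < D) {ε : ℝ} (hε : 0 < ε) :
    ∃ L : ℝ≥0, 0 < L ∧ ∀ h : X →ᵇ ℂ, ‖h‖ ≤ D → LipschitzWith L h →
      ‖b * rho E p μ h - rho E p μ h * b‖ ≤ ε := by
  obtain ⟨R, hR, δ, hδ, hmod⟩ := hb.exists_modulus_of_norm_le hp hD hε
  refine ⟨⟨δ / (2 * R), by positivity⟩, NNReal.coe_pos.1 (show 0 < δ / (2 * R) by positivity),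
    fun h h1 hlip => hmod h h1 fun x y hxy => ?_⟩
  rw [← dist_eq_norm]
  refine (hlip.dist_le_mul x y).trans_lt ?_
  change δ / (2 * R) * dist x y < δ
  calc δ / (2 * R) * dist x y ≤ δ / (2 * R) * R := by gcongr
    _ = δ / 2 := by field_simp
    _ < δ := half_lt_self hδ

end Modulus

/-! ### Commutators with very Lipschitz sequences -/

section VeryLipschitz

variable {X : Type u} [MetricSpace X] [MeasurableSpace X] [BorelSpace X]
  {E : Type v} [NormedAddCommGroup E] [NormedSpace ℂ E]
  {p : ℝ≥0∞} {μ : Measure X} [Fact (1 ≤ p)]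

theorem forall_mem_VLInfty_iff (b : Lp E p μ →L[ℂ] Lp E p μ) :
    (∀ F ∈ VLInfty E p μ, SeqAlg.const b * F - F * SeqAlg.const b = 0) ↔
      ∀ f : ℕ → X →ᵇ ℂ, IsVeryLipschitz f →
        Tendsto (fun n => ‖b * rho E p μ (f n) - rho E p μ (f n) * b‖) atTop (𝓝 0) := by
  constructor
  · intro h f hf
    exact (SeqAlg.const_comm_iff _ _ _).1 (h _ ⟨f, hf, rfl⟩)
  · rintro h _ ⟨f, hf, rfl⟩
    exact (SeqAlg.const_comm_iff _ _ _).2 (h f hf)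

theorem IsQuasiLocal.tendsto_commutator (hp : p ≠ ∞) {b : Lp E p μ →L[ℂ] Lp E p μ}
    (hb : IsQuasiLocal b) {f : ℕ → X →ᵇ ℂ} (hf : IsVeryLipschitz f) :
    Tendsto (fun n => ‖b * rho E p μ (f n) - rho E p μ (f n) * b‖) atTop (𝓝 0) := by
  obtain ⟨⟨C, hC⟩, hlip⟩ := hf
  rw [Metric.tendsto_atTop]
  intro ε hε
  obtain ⟨L, hL, hmod⟩ := hb.exists_lipschitz_modulus hp (D := max C 1)
    (zero_lt_one.trans_le (le_max_right _ _)) (half_pos hε)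
  obtain ⟨n₀, hn₀⟩ := hlip L hL
  refine ⟨n₀, fun n hn => ?_⟩
  rw [dist_zero_right, norm_norm]
  exact (hmod (f n) ((hC n).trans (le_max_left _ _)) (hn₀ n hn)).trans_lt (half_lt_self hε)

/-- If `g` is `1` on the support of `f` and `0` on that of `f'`, then `f [b, g] f' = -f b f'`. When
the supports are more than `n + 1` apart, `g` can be taken `1 / (n + 1)`-Lipschitz, so
counterexamples to quasi-locality yield a very Lipschitz sequence. -/
theorem isQuasiLocal_of_tendsto_commutator {b : Lp E p μ →L[ℂ] Lp E p μ}
    (hb : ∀ f : ℕ → X →ᵇ ℂ, IsVeryLipschitz f →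
      Tendsto (fun n => ‖b * rho E p μ (f n) - rho E p μ (f n) * b‖) atTop (𝓝 0)) :
    IsQuasiLocal b := by
  intro ε hε
  by_contra! hcon
  have h1 : ∀ n : ℕ, ∃ f f' g : X →ᵇ ℂ, ‖f‖ ≤ 1 ∧ ‖f'‖ ≤ 1 ∧
      ε ≤ ‖rho E p μ f * b * rho E p μ f'‖ ∧ ‖g‖ ≤ 1 ∧
      LipschitzWith (1 / ((n : ℝ≥0) + 1)) g ∧ f * g = f ∧ g * f' = 0 := by
    intro n
    have h2 := hcon (n + 1) (by positivity)
    simp only [HasEpsPropagationAtMost] at h2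
    push Not at h2
    obtain ⟨f, f', hf, hf', hd, hle⟩ := h2
    obtain ⟨φ, h0, h1, hlip, hone, hsupp⟩ := exists_bump (tsupport f) 0
      (show 0 < 1 / ((n : ℝ≥0) + 1) by positivity)
    refine ⟨f, f', toC φ, hf, hf', hle, norm_toC_le zero_le_one fun x => ?_,
      lipschitzWith_toC hlip, ?_, ?_⟩
    · rw [abs_of_nonneg (h0 x)]
      exact h1 x
    · ext x
      by_cases hx : f x = 0
      · simp [hx]
      · simp [hone x x (subset_tsupport _ hx) (dist_self x).le]
    · ext x
      by_contra hx
      simp only [BoundedContinuousFunction.mul_apply, toC_apply, BoundedContinuousFunction.coe_zero,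
        Pi.zero_apply, mul_eq_zero, Complex.ofReal_eq_zero, not_or] at hx
      obtain ⟨y, hy, hxy⟩ := hsupp x hx.1
      have h3 := lt_dist_of_lt_setDist hd hy (subset_tsupport _ hx.2)
      rw [dist_comm] at h3
      simp at hxy
      linarith
  choose f f' g hf hf' hle hg hlip hfg hgf using h1
  have hVL : IsVeryLipschitz g := by
    refine ⟨⟨1, hg⟩, fun L hL => ?_⟩
    obtain ⟨n₀, hn₀⟩ := exists_nat_one_div_lt hL
    refine ⟨n₀, fun n hn => (hlip n).weaken ?_⟩
    refine le_trans ?_ hn₀.le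
    gcongr
  have hlim := hb g hVL
  obtain ⟨n, hn⟩ := (hlim.eventually (gt_mem_nhds hε)).exists
  have key : rho E p μ (f n) * (b * rho E p μ (g n) - rho E p μ (g n) * b) * rho E p μ (f' n) =
      -(rho E p μ (f n) * b * rho E p μ (f' n)) := by
    rw [mul_sub, sub_mul, ← mul_assoc, mul_assoc _ (rho E p μ (g n)) (rho E p μ (f' n)),
      ← rho_mul, hgf, rho_zero, mul_zero, zero_sub, ← mul_assoc, ← rho_mul, hfg]
  have h4 : ‖rho E p μ (f n) * b * rho E p μ (f' n)‖ ≤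
      ‖b * rho E p μ (g n) - rho E p μ (g n) * b‖ := by
    rw [← norm_neg, ← key]
    refine (norm_mul_rho_le _ (hf' n) _).trans ?_
    rw [mul_one]
    exact (norm_rho_mul_le _ (hf n) _).trans_eq (one_mul _)
  exact absurd hn (not_lt.2 ((hle n).trans h4))

theorem IsQuasiLocal.of_mem_closure {S : Set (Lp E p μ →L[ℂ] Lp E p μ)}
    (hS : ∀ a ∈ S, IsQuasiLocal a) {b : Lp E p μ →L[ℂ] Lp E p μ} (hb : b ∈ closure S) :
    IsQuasiLocal b := by
  intro ε hε
  obtain ⟨a, ha, hab⟩ := Metric.mem_closure_iff.1 hb (ε / 2) (half_pos hε)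
  obtain ⟨R, hR0, hR⟩ := hS a ha (ε / 2) (half_pos hε)
  refine ⟨R, hR0, fun f f' hf hf' hd => ?_⟩
  have h1 : rho E p μ f * b * rho E p μ f' =
      rho E p μ f * a * rho E p μ f' + rho E p μ f * (b - a) * rho E p μ f' := by
    rw [← add_mul, ← mul_add, add_sub_cancel]
  rw [h1]
  have h2 : ‖rho E p μ f * (b - a) * rho E p μ f'‖ ≤ ‖b - a‖ := by
    refine (norm_mul_rho_le _ hf' _).trans ?_
    rw [mul_one]
    exact (norm_rho_mul_le _ hf _).trans_eq (one_mul _)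
  rw [dist_eq_norm] at hab
  linarith [norm_add_le (rho E p μ f * a * rho E p μ f') (rho E p μ f * (b - a) * rho E p μ f'),
    hR f f' hf hf' hd]

theorem isQuasiLocal_of_mem_Roe {B : Set (Lp E p μ →L[ℂ] Lp E p μ)}
    {b : Lp E p μ →L[ℂ] Lp E p μ} (hb : b ∈ Roe B) : IsQuasiLocal b := by
  refine IsQuasiLocal.of_mem_closure ?_ hb
  rintro a ⟨_, R, hR0, hR⟩ ε hε
  exact ⟨R, hR0, fun f f' _ _ hd => by rw [hR f f' hd, norm_zero]; exact hε⟩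

end VeryLipschitz

/-! ### Commutators with Higson functions -/

section Higson

variable {X : Type u} [MetricSpace X] [MeasurableSpace X] [BorelSpace X]
  {E : Type v} [NormedAddCommGroup E] [NormedSpace ℂ E]
  {p : ℝ≥0∞} {μ : Measure X} [Fact (1 ≤ p)]

theorem IsCutoff.mul_eq_left {x₀ : X} {r s r' s' : ℝ} {L L' : ℝ≥0} {e e' : X →ᵇ ℂ}
    (he : IsCutoff x₀ r s L e) (he' : IsCutoff x₀ r' s' L' e') (h : s ≤ r') : e * e' = e := by
  ext x
  rw [BoundedContinuousFunction.mul_apply]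
  rcases le_total (dist x x₀) r' with hx | hx
  · rw [he'.eq_one x hx, mul_one]
  · rw [he.eq_zero x (h.trans hx), zero_mul]

theorem IsCutoff.le_dist {x₀ : X} {r s r' s' : ℝ} {L L' : ℝ≥0} {e e' : X →ᵇ ℂ}
    (he : IsCutoff x₀ r s L e) (he' : IsCutoff x₀ r' s' L' e') {x y : X} (hx : x ∈ tsupport e)
    (hy : y ∈ tsupport (1 - e' : X →ᵇ ℂ)) : r' - s ≤ dist x y := by
  have hx' := tsupport_subset_of_continuous (f := e) (u := fun x => dist x x₀)
    (by fun_prop) (isClosed_Iic (a := s))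
    (fun x hx => by by_contra h; exact hx (he.eq_zero x (not_le.1 h).le)) x hx
  have hy' := tsupport_subset_of_continuous (f := 1 - e') (u := fun x => dist x x₀)
    (by fun_prop) (isClosed_Ici (a := r'))
    (fun x hx => by
      by_contra h
      refine hx ?_
      rw [BoundedContinuousFunction.sub_apply, he'.eq_one x (not_le.1 h).le]
      simp) y hy
  simp only [Set.mem_Iic, Set.mem_Ici] at hx' hy'
  have := dist_triangle_left y x₀ x
  linarith

theorem mem_of_cbMulCb_eq {B : Set (Lp E p μ →L[ℂ] Lp E p μ)} (hB : cbMulCb B = B)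
    {b : Lp E p μ →L[ℂ] Lp E p μ} (hb : b ∈ B) (f g : X →ᵇ ℂ) :
    rho E p μ f * b * rho E p μ g ∈ B := by
  rw [← hB]
  exact ⟨f, b, hb, g, rfl⟩

theorem commutator_mem {B : NonUnitalSubalgebra ℂ (Lp E p μ →L[ℂ] Lp E p μ)}
    (hB : cbMulCb (B : Set (Lp E p μ →L[ℂ] Lp E p μ)) = B)
    {b : Lp E p μ →L[ℂ] Lp E p μ} (hb : b ∈ B) (g : X →ᵇ ℂ) :
    b * rho E p μ g - rho E p μ g * b ∈ B := by
  have h1 := mem_of_cbMulCb_eq hB hb 1 g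
  have h2 := mem_of_cbMulCb_eq hB hb g 1
  rw [rho_one, one_mul] at h1
  rw [rho_one, mul_one] at h2
  exact sub_mem h1 h2

/-- With a slowly varying cutoff `e` that is `1` on the exceptional compact set, `(1 - e) g` has
small variation everywhere, so `[b, g]` is close to `[b, e g]`. If `e'` is `1` far beyond the
support of `e`, quasi-locality makes this close to `e' [b, e g] e'`. -/
theorem IsQuasiLocal.commutator_mem_KIdeal [ProperSpace X] (hp : p ≠ ∞) (x₀ : X)
    {B : NonUnitalSubalgebra ℂ (Lp E p μ →L[ℂ] Lp E p μ)}
    (hB : cbMulCb (B : Set (Lp E p μ →L[ℂ] Lp E p μ)) = B)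
    {b : Lp E p μ →L[ℂ] Lp E p μ} (hbB : b ∈ B) (hb : IsQuasiLocal b) {g : X →ᵇ ℂ}
    (hg : IsHigson g) :
    b * rho E p μ g - rho E p μ g * b ∈ KIdeal (B : Set (Lp E p μ →L[ℂ] Lp E p μ)) := by
  refine Metric.mem_closure_iff.2 fun ε hε => ?_
  set D := ‖g‖ + 1 with hD
  have hD0 : 0 < D := by positivity
  have hgD : ‖g‖ ≤ D := by linarith
  obtain ⟨R, hR, δ, hδ, hmod⟩ := hb.exists_modulus_of_norm_le hp hD0 (half_pos hε)
  obtain ⟨A, hA, hvar⟩ := hg (R + 1) (by linarith) (δ / 2) (half_pos hδ)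
  obtain ⟨r, hr⟩ := hA.isBounded.subset_closedBall x₀
  -- At scale `R` the cutoff then varies by at most `δ / (4D)`, so its contribution to the variation
  -- of `(1 - e) g` is at most `δ / 4`; `g` itself contributes less than `δ / 2`.
  let lam : ℝ≥0 := ⟨δ / (4 * R * D), by positivity⟩
  have hlam : 0 < lam := NNReal.coe_pos.1 (show 0 < δ / (4 * R * D) by positivity)
  obtain ⟨e, he⟩ := exists_isCutoff x₀ r hlam
  have helip : ∀ x y, dist x y ≤ R → ‖e x - e y‖ * D ≤ δ / 4 := by
    intro x y hxy
    rw [← dist_eq_norm]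
    calc dist (e x) (e y) * D ≤ (lam * dist x y) * D := by
          gcongr; exact he.lipschitz.dist_le_mul x y
      _ ≤ (δ / (4 * R * D) * R) * D := by gcongr; exact le_rfl
      _ = δ / 4 := by field_simp
  have hAe : ∀ x ∈ A, e x = 1 := fun x hx => he.eq_one x (hr hx)
  have hgx : ∀ x, ‖g x‖ ≤ D := fun x => (g.norm_coe_le_norm x).trans hgD
  have hsmall : ‖b * rho E p μ ((1 - e) * g) - rho E p μ ((1 - e) * g) * b‖ ≤ ε / 2 := by
    refine hmod _ ?_ fun x y hxy => ?_
    · refine (norm_mul_le _ _).trans ?_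
      exact (mul_le_of_le_one_left (norm_nonneg _) he.norm_one_sub_le).trans hgD
    · have h2 := helip x y hxy
      have h3 := helip y x (by rwa [dist_comm])
      simp only [BoundedContinuousFunction.mul_apply, BoundedContinuousFunction.sub_apply,
        BoundedContinuousFunction.coe_one, Pi.one_apply]
      by_cases hx : x ∈ A
      · rw [hAe x hx, sub_self, zero_mul, zero_sub, norm_neg, norm_mul]
        rw [hAe x hx] at h2
        have : ‖1 - e y‖ * ‖g y‖ ≤ ‖1 - e y‖ * D := by gcongr; exact hgx y
        linarith
      by_cases hy : y ∈ A
      · rw [hAe y hy, sub_self, zero_mul, sub_zero, norm_mul]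
        rw [hAe y hy] at h3
        have : ‖1 - e x‖ * ‖g x‖ ≤ ‖1 - e x‖ * D := by gcongr; exact hgx x
        linarith
      · have h4 := hvar x hx y hy (by linarith)
        have h5 : ‖1 - e x‖ ≤ 1 := ((1 - e).norm_coe_le_norm x).trans he.norm_one_sub_le
        rw [show (1 - e x) * g x - (1 - e y) * g y =
          (1 - e x) * (g x - g y) + (e y - e x) * g y by ring]
        refine (norm_add_le _ _).trans_lt ?_
        rw [norm_mul, norm_mul]
        have h6 : ‖1 - e x‖ * ‖g x - g y‖ ≤ ‖g x - g y‖ :=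
          mul_le_of_le_one_left (norm_nonneg _) h5
        have h7 : ‖e y - e x‖ * ‖g y‖ ≤ ‖e y - e x‖ * D := by gcongr; exact hgx y
        linarith
  obtain ⟨R₁, hR₁0, hR₁⟩ := hb (ε / (8 * D)) (by positivity)
  obtain ⟨e', he'⟩ := exists_isCutoff x₀ (r + 1 / lam + (R₁ + 1)) one_pos
  have hee' := he.mul_eq_left he' (by linarith)
  have hfar₁ : ‖rho E p μ e * b * rho E p μ (1 - e')‖ ≤ ε / (8 * D) :=
    (hR₁ _ _ he.norm_le he'.norm_one_sub_le (lt_setDist_of_forall_le hR₁0 (lt_add_one R₁)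
      fun x hx y hy => by linarith [he.le_dist he' hx hy])).le
  have hfar₂ : ‖rho E p μ (1 - e') * b * rho E p μ e‖ ≤ ε / (8 * D) :=
    (hR₁ _ _ he'.norm_one_sub_le he.norm_le (lt_setDist_of_forall_le hR₁0 (lt_add_one R₁)
      fun x hx y hy => by rw [dist_comm]; linarith [he.le_dist he' hy hx])).le
  obtain ⟨c, hc⟩ := he'.exists_zeroAtInfty
  refine ⟨_, ⟨c, _, commutator_mem hB hbB (e * g), c, rfl⟩, ?_⟩
  rw [hc, dist_eq_norm]
  have hdec : b * rho E p μ g - rho E p μ g * b -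
      rho E p μ e' * (b * rho E p μ (e * g) - rho E p μ (e * g) * b) * rho E p μ e' =
      (b * rho E p μ ((1 - e) * g) - rho E p μ ((1 - e) * g) * b) +
        (rho E p μ (1 - e') * b * rho E p μ e * rho E p μ g -
          rho E p μ g * (rho E p μ e * b * rho E p μ (1 - e'))) := by
    have h1 : rho E p μ (e * g) * rho E p μ e' = rho E p μ e * rho E p μ g := by
      rw [← rho_mul, ← rho_mul, mul_right_comm, hee']
    have h2 : rho E p μ e' * rho E p μ (e * g) = rho E p μ g * rho E p μ e := by
      rw [← rho_mul, ← rho_mul, mul_comm g, ← mul_assoc, mul_comm e', hee']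
    have h3 : rho E p μ e' * (b * rho E p μ (e * g) - rho E p μ (e * g) * b) * rho E p μ e' =
        rho E p μ e' * b * (rho E p μ e * rho E p μ g) -
          rho E p μ g * rho E p μ e * b * rho E p μ e' := by
      rw [← h1, ← h2]
      noncomm_ring
    rw [h3, rho_mul, rho_sub, rho_one, rho_sub, rho_one, ← sub_eq_zero]
    have h4 := rho_comm (E := E) (p := p) (μ := μ) e g
    have h5 : (1 - rho E p μ e) * rho E p μ g = rho E p μ g - rho E p μ g * rho E p μ e := by
      rw [sub_mul, one_mul, h4]
    have h6 : b * (rho E p μ g - rho E p μ g * rho E p μ e) =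
        b * rho E p μ g - b * (rho E p μ e * rho E p μ g) := by
      rw [mul_sub, h4]
    rw [h5, h6]
    noncomm_ring
  rw [hdec]
  have h1 := norm_mul_rho_le g hgD (rho E p μ (1 - e') * b * rho E p μ e)
  have h2 := norm_rho_mul_le g hgD (rho E p μ e * b * rho E p μ (1 - e'))
  have h3 : ‖rho E p μ (1 - e') * b * rho E p μ e‖ * D ≤ ε / 8 :=
    (mul_le_mul_of_nonneg_right hfar₂ hD0.le).trans_eq (by field_simp)
  have h4 : D * ‖rho E p μ e * b * rho E p μ (1 - e')‖ ≤ ε / 8 :=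
    (mul_le_mul_of_nonneg_left hfar₁ hD0.le).trans_eq (by field_simp)
  have h5 := norm_sub_le (rho E p μ (1 - e') * b * rho E p μ e * rho E p μ g)
    (rho E p μ g * (rho E p μ e * b * rho E p μ (1 - e')))
  refine (norm_add_le _ _).trans_lt ?_
  linarith

end Higson

/-! ### Gluing functions on annuli into a Higson function. -/

section Gluing

variable {X : Type u} [MetricSpace X]

theorem lipschitzWith_mul {A : Type*} [NormedRing A] {f g : X →ᵇ A} {K K' C D : ℝ≥0}
    (hf : LipschitzWith K f) (hg : LipschitzWith K' g) (hfC : ‖f‖ ≤ C) (hgD : ‖g‖ ≤ D) :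
    LipschitzWith (K * D + C * K') (f * g) := by
  refine LipschitzWith.of_dist_le_mul fun x y => ?_
  rw [dist_eq_norm]
  simp only [BoundedContinuousFunction.mul_apply]
  rw [show f x * g x - f y * g y = (f x - f y) * g x + f y * (g x - g y) by noncomm_ring,
    NNReal.coe_add, NNReal.coe_mul, NNReal.coe_mul]
  refine (norm_add_le _ _).trans ?_
  have h1 := hf.dist_le_mul x y
  have h2 := hg.dist_le_mul x y
  rw [dist_eq_norm] at h1 h2
  have h3 := (g.norm_coe_le_norm x).trans hgD
  have h4 := (f.norm_coe_le_norm y).trans hfC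
  calc ‖(f x - f y) * g x‖ + ‖f y * (g x - g y)‖
      ≤ ‖f x - f y‖ * ‖g x‖ + ‖f y‖ * ‖g x - g y‖ := by gcongr <;> exact norm_mul_le _ _
    _ ≤ (K * dist x y) * D + C * (K' * dist x y) := by gcongr
    _ = _ := by ring

theorem IsCutoff.isHigson [ProperSpace X] {x₀ : X} {r s : ℝ} {L : ℝ≥0} {e : X →ᵇ ℂ}
    (he : IsCutoff x₀ r s L e) : IsHigson e := by
  intro R _ ε hε
  refine ⟨Metric.closedBall x₀ s, isCompact_closedBall x₀ s, fun x hx y hy _ => ?_⟩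
  rw [Metric.mem_closedBall, not_le] at hx hy
  rw [he.eq_zero x hx.le, he.eq_zero y hy.le, sub_zero, norm_zero]
  exact hε

/-- Functions with supports in consecutive annuli and with Lipschitz constants tending to `0` add up
to a Higson function. -/
theorem exists_isHigson_glue [ProperSpace X] (x₀ : X) {r : ℕ → ℝ} (hr : ∀ k : ℕ, k ≤ r k)
    (hmono : Monotone r) {D : ℝ} {g : ℕ → X →ᵇ ℂ} (hD : ∀ k, ‖g k‖ ≤ D)
    (hlip : ∀ k : ℕ, LipschitzWith (1 / ((k : ℝ≥0) + 1)) (g k))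
    (hsupp : ∀ k x, g k x ≠ 0 → r k < dist x x₀ ∧ dist x x₀ < r (k + 1)) :
    ∃ G : X →ᵇ ℂ, IsHigson G ∧
      ∀ k x, r k ≤ dist x x₀ → dist x x₀ ≤ r (k + 1) → G x = g k x := by
  have huniq : ∀ k j x, r k ≤ dist x x₀ → dist x x₀ ≤ r (k + 1) → j ≠ k → g j x = 0 := by
    intro k j x h1 h2 hjk
    by_contra h
    obtain ⟨h3, h4⟩ := hsupp j x h
    rcases lt_or_gt_of_ne hjk with hlt | hlt
    · linarith [hmono (Nat.succ_le_of_lt hlt)]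
    · linarith [hmono (Nat.succ_le_of_lt hlt)]
  have hval : ∀ k x, r k ≤ dist x x₀ → dist x x₀ ≤ r (k + 1) →
      ∑ᶠ j, g j x = g k x := fun k x h1 h2 =>
    finsum_eq_single _ k fun j hj => huniq k j x h1 h2 hj
  have hcase : ∀ x, ∃ k, ∑ᶠ j, g j x = g k x ∧ ∀ j ≠ k, g j x = 0 := by
    intro x
    by_cases h : ∃ k, g k x ≠ 0
    · obtain ⟨k, hk⟩ := h
      obtain ⟨h1, h2⟩ := hsupp k x hk
      exact ⟨k, hval k x h1.le h2.le, fun j hj => huniq k j x h1.le h2.le hj⟩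
    · push Not at h
      exact ⟨0, by simp [h], fun j _ => h j⟩
  have hcont : Continuous fun x => ∑ᶠ j, g j x := by
    refine continuous_finsum (fun j => (g j).continuous) fun x => ?_
    refine ⟨Metric.ball x 1, Metric.ball_mem_nhds x one_pos,
      (Set.finite_Iic ⌈dist x x₀ + 1⌉₊).subset ?_⟩
    rintro k ⟨y, hy, hyx⟩
    have h1 := (hsupp k y hy).1
    have h2 := dist_triangle y x x₀
    rw [Metric.mem_ball] at hyx
    have h3 : (k : ℝ) ≤ dist x x₀ + 1 := by linarith [hr k]
    exact_mod_cast h3.trans (Nat.le_ceil _)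
  have hbdd : ∀ x, ‖∑ᶠ j, g j x‖ ≤ D := by
    intro x
    obtain ⟨k, hk, -⟩ := hcase x
    rw [hk]
    exact ((g k).norm_coe_le_norm x).trans (hD k)
  refine ⟨BoundedContinuousFunction.ofNormedAddCommGroup _ hcont D hbdd, ?_, hval⟩
  intro R hR ε hε
  obtain ⟨K, hK⟩ := exists_nat_gt (2 * R / ε)
  refine ⟨Metric.closedBall x₀ (r K), isCompact_closedBall x₀ _, fun x hx y hy hxy => ?_⟩
  rw [Metric.mem_closedBall, not_le] at hx hy
  change ‖∑ᶠ j, g j x - ∑ᶠ j, g j y‖ < ε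
  have hbound : ∀ k, ∀ z w : X, r K < dist z x₀ → r K < dist w x₀ → dist z w < R →
      ‖g k z - g k w‖ ≤ R / (K + 1) := by
    intro k z w hz hw hzw
    by_cases hk : K ≤ k
    · rw [← dist_eq_norm]
      refine ((hlip k).dist_le_mul z w).trans ?_
      rw [NNReal.coe_div, NNReal.coe_add, NNReal.coe_natCast, NNReal.coe_one, one_div_mul_eq_div]
      gcongr
    · rw [not_le] at hk
      have h0 : ∀ v, r K < dist v x₀ → g k v = 0 := by
        intro v hv
        by_contra h
        linarith [(hsupp k v h).2, hmono (Nat.succ_le_of_lt hk)]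
      rw [h0 z hz, h0 w hw, sub_zero, norm_zero]
      positivity
  have hfin : 2 * (R / (K + 1)) < ε := by
    rw [div_lt_iff₀ hε] at hK
    rw [← mul_div_assoc, div_lt_iff₀ (by positivity)]
    linarith
  have hRK : 0 ≤ R / (K + 1 : ℝ) := by positivity
  obtain ⟨i, hi, hi'⟩ := hcase x
  obtain ⟨j, hj, hj'⟩ := hcase y
  rw [hi, hj]
  by_cases hij : i = j
  · subst hij
    linarith [hbound i x y hx hy hxy]
  -- Here `g i` vanishes at `y` and `g j` at `x`, so each of the two values is itself a difference
  -- of values of a single function.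
  · have h1 := hbound i x y hx hy hxy
    have h2 := hbound j x y hx hy hxy
    rw [hj' i hij, sub_zero] at h1
    rw [hi' j (Ne.symm hij), zero_sub, norm_neg] at h2
    linarith [norm_sub_le (g i x) (g j y)]

end Gluing

/-! ### From Higson commutators to very Lipschitz sequences. -/

section HigsonConverse

variable {X : Type u} [MetricSpace X] [MeasurableSpace X] [BorelSpace X]
  {E : Type v} [NormedAddCommGroup E] [NormedSpace ℂ E]
  {p : ℝ≥0∞} {μ : Measure X} [Fact (1 ≤ p)]

/-- Elements of `𝒦(X, B)` are small far away from `x₀`. -/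
theorem exists_radius_of_mem_KIdeal (x₀ : X) {B : Set (Lp E p μ →L[ℂ] Lp E p μ)}
    {T : Lp E p μ →L[ℂ] Lp E p μ} (hT : T ∈ KIdeal B) {D δ : ℝ} (hD : 0 < D) (hδ : 0 < δ) :
    ∃ s : ℝ, ∀ g : X →ᵇ ℂ, ‖g‖ ≤ D → (∀ x, dist x x₀ ≤ s → g x = 0) →
      ‖T * rho E p μ g‖ ≤ δ ∧ ‖rho E p μ g * T‖ ≤ δ := by
  obtain ⟨_, ⟨f, b, -, f', rfl⟩, hdist⟩ := Metric.mem_closure_iff.1 hT (δ / (2 * D)) (by positivity)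
  rw [dist_eq_norm] at hdist
  set S := rho E p μ f.toBCF * b * rho E p μ f'.toBCF with hS
  set Q := ‖rho E p μ f.toBCF * b‖ + ‖b * rho E p μ f'.toBCF‖ + 1 with hQ
  have hQ0 : 0 < Q := by positivity
  have hη : 0 < δ / (2 * D * Q) := by positivity
  have hsmall : ∀ φ : C₀(X, ℂ), ∃ s : ℝ, ∀ x, s < dist x x₀ → ‖φ x‖ ≤ δ / (2 * D * Q) := by
    intro φ
    have h1 := φ.zero_at_infty'.eventually (Metric.ball_mem_nhds 0 hη)
    obtain ⟨K, hK, hKs⟩ := mem_cocompact.1 h1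
    obtain ⟨s, hs⟩ := hK.isBounded.subset_closedBall x₀
    refine ⟨s, fun x hx => ?_⟩
    have h2 : x ∈ Kᶜ := fun hxK => by
      have := hs hxK
      rw [Metric.mem_closedBall] at this
      linarith
    have h3 := hKs h2
    simpa using (mem_ball_zero_iff.1 h3).le
  obtain ⟨s, hs⟩ := hsmall f
  obtain ⟨s', hs'⟩ := hsmall f'
  have hprod : ∀ (φ : C₀(X, ℂ)) (t : ℝ), (∀ x, t < dist x x₀ → ‖φ x‖ ≤ δ / (2 * D * Q)) →
      ∀ g : X →ᵇ ℂ, ‖g‖ ≤ D → (∀ x, dist x x₀ ≤ t → g x = 0) →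
      ‖φ.toBCF * g‖ ≤ δ / (2 * Q) := by
    intro φ t ht g hg hg0
    refine (BoundedContinuousFunction.norm_le (by positivity)).2 fun x => ?_
    rw [BoundedContinuousFunction.mul_apply, norm_mul]
    rcases le_or_gt (dist x x₀) t with hx | hx
    · rw [hg0 x hx, norm_zero, mul_zero]
      positivity
    · calc ‖φ x‖ * ‖g x‖ ≤ δ / (2 * D * Q) * D := by
            gcongr
            · exact ht x hx
            · exact (g.norm_coe_le_norm x).trans hg
        _ = δ / (2 * Q) := by field_simp
  have hfin : ∀ t, t ≤ Q → t * (δ / (2 * Q)) ≤ δ / 2 := by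
    intro t ht
    calc t * (δ / (2 * Q)) ≤ Q * (δ / (2 * Q)) := by gcongr
      _ = δ / 2 := by field_simp
  have hTS : ‖T - S‖ * D ≤ δ / 2 := by
    calc ‖T - S‖ * D ≤ δ / (2 * D) * D := by gcongr
      _ = δ / 2 := by field_simp
  refine ⟨max s s', fun g hg hg0 => ⟨?_, ?_⟩⟩
  · rw [show T * rho E p μ g = (T - S) * rho E p μ g + S * rho E p μ g by noncomm_ring]
    have h1 := norm_mul_rho_le g hg (T - S)
    have h2 := norm_mul_rho_le (f'.toBCF * g) (hprod f' s' hs' g hg fun x hx =>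
      hg0 x (hx.trans (le_max_right _ _))) (rho E p μ f.toBCF * b)
    rw [rho_mul, ← mul_assoc, ← hS] at h2
    have h3 := hfin ‖rho E p μ f.toBCF * b‖ (by
      linarith [norm_nonneg (b * rho E p μ f'.toBCF)])
    linarith [norm_add_le ((T - S) * rho E p μ g) (S * rho E p μ g)]
  · rw [show rho E p μ g * T = rho E p μ g * (T - S) + rho E p μ g * S by noncomm_ring]
    have h1 := norm_rho_mul_le g hg (T - S)
    have h2 := norm_rho_mul_le (f.toBCF * g) (hprod f s hs g hg fun x hx =>
      hg0 x (hx.trans (le_max_left _ _))) (b * rho E p μ f'.toBCF)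
    rw [mul_comm f.toBCF, rho_mul, mul_assoc, ← mul_assoc _ b, ← hS] at h2
    have h3 := hfin ‖b * rho E p μ f'.toBCF‖ (by
      linarith [norm_nonneg (rho E p μ f.toBCF * b)])
    linarith [norm_add_le (rho E p μ g * (T - S)) (rho E p μ g * S)]

/-- If `b` commutes with Higson functions modulo `𝒦(X, B)`, its matrix coefficients between a ball
and the complement of a large ball are small. -/
theorem exists_radius_of_commutator_mem_KIdeal [ProperSpace X] {x₀ : X}
    {B : Set (Lp E p μ →L[ℂ] Lp E p μ)} {b : Lp E p μ →L[ℂ] Lp E p μ}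
    (hb : ∀ g : X →ᵇ ℂ, IsHigson g → b * rho E p μ g - rho E p μ g * b ∈ KIdeal B)
    {D δ : ℝ} (hD : 0 < D) (hδ : 0 < δ) {r s : ℝ} {L : ℝ≥0} {e : X →ᵇ ℂ}
    (he : IsCutoff x₀ r s L e) :
    ∃ t ≥ s, ∀ g : X →ᵇ ℂ, ‖g‖ ≤ D → (∀ x, dist x x₀ ≤ t → g x = 0) →
      ‖rho E p μ e * b * rho E p μ g‖ ≤ δ ∧ ‖rho E p μ g * b * rho E p μ e‖ ≤ δ := by
  -- A compactly supported `e'` is Higson. If `e e' = e` and `e' g = 0`, then `e b g = -e [b, e'] g`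
  -- and `g b e = g [b, e'] e`, and membership in `𝒦(X, B)` makes these small for `g` far out.
  obtain ⟨e', he'⟩ := exists_isCutoff x₀ s one_pos
  have hee' := he.mul_eq_left he' le_rfl
  obtain ⟨t, ht⟩ := exists_radius_of_mem_KIdeal x₀ (hb e' he'.isHigson) hD hδ
  refine ⟨max s (max t (s + 1 / (1 : ℝ≥0))), le_max_left _ _, fun g hg hg0 => ?_⟩
  have hg0' : e' * g = 0 := by
    ext x
    rw [BoundedContinuousFunction.mul_apply]
    rcases le_total (dist x x₀) (s + 1 / (1 : ℝ≥0)) with hx | hx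
    · rw [hg0 x (hx.trans ((le_max_right _ _).trans (le_max_right _ _))), mul_zero]
      rfl
    · rw [he'.eq_zero x hx, zero_mul]
      rfl
  obtain ⟨h1, h2⟩ := ht g hg fun x hx => hg0 x (hx.trans ((le_max_left _ _).trans
    (le_max_right _ _)))
  set c := b * rho E p μ e' - rho E p μ e' * b with hc
  have h3 : rho E p μ e * b * rho E p μ g = -(rho E p μ e * (c * rho E p μ g)) := by
    rw [hc, sub_mul, mul_assoc b, ← rho_mul, hg0', rho_zero, mul_zero, zero_sub, mul_neg, neg_neg,
      ← mul_assoc, ← mul_assoc, ← rho_mul, hee']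
  have h4 : rho E p μ g * b * rho E p μ e = rho E p μ g * c * rho E p μ e := by
    rw [hc, mul_sub, ← mul_assoc (rho E p μ g) (rho E p μ e'), ← rho_mul, mul_comm g, hg0',
      rho_zero, zero_mul, sub_zero, mul_assoc, mul_assoc, mul_assoc, ← rho_mul, mul_comm e', hee']
  constructor
  · rw [h3, norm_neg]
    refine (norm_rho_mul_le _ he.norm_le _).trans ?_
    rwa [one_mul]
  · rw [h4]
    refine (norm_mul_rho_le _ he.norm_le _).trans ?_
    rwa [mul_one]

/-- A very Lipschitz sequence with large commutators can be localised far out. -/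
theorem exists_localized_commutator (hp : p ≠ ∞) (x₀ : X) {b : Lp E p μ →L[ℂ] Lp E p μ}
    {f : ℕ → X →ᵇ ℂ} {C : ℝ≥0} (hC : ∀ n, ‖f n‖ ≤ C)
    (hlip : ∀ L : ℝ≥0, 0 < L → ∃ n₀ : ℕ, ∀ n ≥ n₀, LipschitzWith L (f n)) {ε : ℝ} (hε : 0 < ε)
    (hbig : ∃ᶠ n in atTop, ε ≤ ‖b * rho E p μ (f n) - rho E p μ (f n) * b‖)
    {r : ℝ} (hr : 0 ≤ r) {lam : ℝ≥0} (hlam : 0 < lam) :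
    ∃ (g : X →ᵇ ℂ) (t : ℝ), r ≤ t ∧ ‖g‖ ≤ 2 * C ∧ LipschitzWith lam g ∧
      (∀ x, dist x x₀ ≤ r → g x = 0) ∧ (∀ x, t ≤ dist x x₀ → g x = 0) ∧
      ε / 2 < ‖b * rho E p μ g - rho E p μ g * b‖ := by
  -- Two cutoffs multiply a function of norm at most `2C`, adding `4 C lam' ≤ lam / 2` to its
  -- Lipschitz constant; the other half of `lam` is left for `L`.
  set lam' : ℝ≥0 := lam / (8 * (C + 1)) with hlam'
  have hlam'0 : 0 < lam' := by positivity
  obtain ⟨e, he⟩ := exists_isCutoff x₀ r hlam'0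
  set S : ℝ≥0 := ⟨r, hr⟩ + 1 / lam' with hS
  have hS0 : 0 < S := by positivity
  have hScoe : (S : ℝ) = r + 1 / lam' := by simp [hS]; rfl
  let ε' : ℝ≥0 := ⟨ε, hε.le⟩
  have hε' : 0 < ε' := hε
  -- The second entry bounds the part of the function near `x₀` by `L * S`, so that its commutator
  -- with `b` is at most `ε / 4`.
  set L : ℝ≥0 := min (lam / 2) (ε' / (8 * (‖b‖₊ + 1) * S)) with hL
  have hL0 : 0 < L := lt_min (by positivity) (by positivity)
  obtain ⟨n₀, hn₀⟩ := hlip L hL0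
  obtain ⟨n, hn, hbn⟩ := frequently_atTop.1 hbig n₀
  have hfn := hn₀ n hn
  -- Subtracting a constant leaves the commutator unchanged and makes the function vanish at `x₀`,
  -- hence small on a fixed ball.
  let F : X →ᵇ ℂ := f n - (f n x₀) • (1 : X →ᵇ ℂ)
  have hFx : ∀ x, F x = f n x - f n x₀ := fun x => by simp [F]
  have hFlip : LipschitzWith L F := by
    refine LipschitzWith.of_dist_le_mul fun x y => ?_
    rw [hFx, hFx, dist_sub_right]
    exact hfn.dist_le_mul x y
  have hFC : ‖F‖ ≤ (2 * C : ℝ≥0) := by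
    refine (BoundedContinuousFunction.norm_le (by positivity)).2 fun x => ?_
    rw [hFx]
    have h1 := ((f n).norm_coe_le_norm x).trans (hC n)
    have h2 := ((f n).norm_coe_le_norm x₀).trans (hC n)
    push_cast
    linarith [norm_sub_le (f n x) (f n x₀)]
  have hnear : ‖F * e‖ ≤ L * S := by
    refine (BoundedContinuousFunction.norm_le (by positivity)).2 fun x => ?_
    rw [BoundedContinuousFunction.mul_apply, norm_mul]
    rcases le_total (dist x x₀) S with hx | hx
    · refine (mul_le_of_le_one_right (norm_nonneg _)
        ((e.norm_coe_le_norm x).trans he.norm_le)).trans ?_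
      rw [hFx, ← dist_eq_norm]
      exact (hfn.dist_le_mul x x₀).trans (by gcongr)
    · rw [he.eq_zero x (hScoe ▸ hx), norm_zero, mul_zero]
      positivity
  have hnear' : ‖b * rho E p μ (F * e) - rho E p μ (F * e) * b‖ ≤ ε / 4 := by
    refine (norm_commutator_le b (F * e)).trans ?_
    have h1 : (L : ℝ) ≤ ε / (8 * (‖b‖ + 1) * S) := by
      have : L ≤ ε' / (8 * (‖b‖₊ + 1) * S) := min_le_right _ _
      exact_mod_cast this
    have hS0' : (0 : ℝ) < S := hS0
    calc 2 * ‖b‖ * ‖F * e‖ ≤ 2 * (‖b‖ + 1) * (ε / (8 * (‖b‖ + 1) * S) * S) := by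
          gcongr
          · linarith
          · exact hnear.trans (by gcongr)
      _ = ε / 4 := by field_simp; norm_num
  set h : X →ᵇ ℂ := F * (1 - e) with hh
  have hhC : ‖h‖ ≤ (2 * C : ℝ≥0) :=
    (norm_mul_le _ _).trans ((mul_le_of_le_one_right (norm_nonneg _) he.norm_one_sub_le).trans hFC)
  have h1elip : LipschitzWith lam' (1 - e : X →ᵇ ℂ) := by
    refine LipschitzWith.of_dist_le_mul fun x y => ?_
    change dist (1 - e x) (1 - e y) ≤ _
    rw [dist_sub_left]
    exact he.lipschitz.dist_le_mul x y
  have hhlip : LipschitzWith (L * 1 + 2 * C * lam') h :=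
    lipschitzWith_mul hFlip h1elip hFC (by simpa using he.norm_one_sub_le)
  have hbh : ε / 2 < ‖b * rho E p μ h - rho E p μ h * b‖ := by
    have hdec : f n = F * e + h + f n x₀ • (1 : X →ᵇ ℂ) := by
      rw [hh, ← mul_add, add_sub_cancel, mul_one]
      simp [F]
    have h2 : b * rho E p μ (f n) - rho E p μ (f n) * b =
        (b * rho E p μ (F * e) - rho E p μ (F * e) * b) +
          (b * rho E p μ h - rho E p μ h * b) := by
      conv_lhs => rw [hdec]
      simp only [rho_add, rho_smul, rho_one, mul_add, add_mul, mul_smul_comm, smul_mul_assoc,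
        mul_one, one_mul]
      abel
    rw [h2] at hbn
    linarith [norm_add_le (b * rho E p μ (F * e) - rho E p μ (F * e) * b)
      (b * rho E p μ h - rho E p μ h * b)]
  -- Cutoffs converge only strongly, so the lower bound is witnessed by one vector before the
  -- function is truncated at infinity.
  obtain ⟨ξ, hξ⟩ : ∃ ξ : Lp E p μ,
      ε / 2 * ‖ξ‖ < ‖(b * rho E p μ h - rho E p μ h * b) ξ‖ := by
    by_contra! hcon
    exact absurd (ContinuousLinearMap.opNorm_le_bound _ (by positivity) hcon) (not_le.2 hbh)
  choose e' he' using fun m : ℕ => exists_isCutoff x₀ (m : ℝ) hlam'0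
  have hlim : Tendsto (fun m => (b * rho E p μ (h * e' m) - rho E p μ (h * e' m) * b) ξ) atTop
      (𝓝 ((b * rho E p μ h - rho E p μ h * b) ξ)) := by
    have hcut := tendsto_rho_cutoff (E := E) (μ := μ) hp x₀ (fun m => (he' m).norm_one_sub_le)
      (fun m => (he' m).eq_one)
    have h1 := (((b * rho E p μ h).continuous.tendsto ξ).comp (hcut ξ)).sub
      (((rho E p μ h).continuous.tendsto (b ξ)).comp (hcut (b ξ)))
    refine h1.congr fun m => ?_
    rw [rho_mul h]
    rfl
  obtain ⟨m, hm, hmr⟩ := ((hlim.norm.eventually (lt_mem_nhds hξ)).and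
    (eventually_ge_atTop ⌈r⌉₊)).exists
  have hmr' : r ≤ m := (Nat.le_ceil r).trans (by exact_mod_cast hmr)
  refine ⟨h * e' m, m + 1 / lam', ?_, ?_, ?_, fun x hx => ?_, fun x hx => ?_, ?_⟩
  · have : (0 : ℝ) ≤ 1 / lam' := by positivity
    linarith
  · refine (norm_mul_le _ _).trans ((mul_le_of_le_one_right (norm_nonneg _)
      (he' m).norm_le).trans ?_)
    exact_mod_cast hhC
  · refine (lipschitzWith_mul hhlip (he' m).lipschitz hhC
      (D := 1) (by simpa using (he' m).norm_le)).weaken ?_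
    rw [← NNReal.coe_le_coe]
    have h1 : (L : ℝ) ≤ lam / 2 := by
      have : L ≤ lam / 2 := min_le_left _ _
      exact_mod_cast this
    have h2 : (C : ℝ) * lam' ≤ lam / 8 := by
      rw [hlam']
      push_cast
      rw [mul_div_assoc', div_le_div_iff₀ (by positivity) (by norm_num)]
      nlinarith [lam.coe_nonneg, C.coe_nonneg]
    push_cast
    linarith
  · simp only [hh, BoundedContinuousFunction.mul_apply, BoundedContinuousFunction.sub_apply,
      BoundedContinuousFunction.coe_one, Pi.one_apply]
    rw [he.eq_one x hx, sub_self, mul_zero, zero_mul]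
  · rw [BoundedContinuousFunction.mul_apply, (he' m).eq_zero x hx, mul_zero]
  · by_contra! hcon
    exact absurd hm (not_lt.2 (ContinuousLinearMap.le_of_opNorm_le _ hcon ξ))

/-- Let `H` be the glued Higson function and `h` a cutoff to the `k`-th annulus, equal to `1` on the
support of `g k`. Then `h H = g k`, and `[b, g k]` equals `h [b, H] h` up to coefficients of `b`
between `g k` and the region where `h ≠ 1`. The former is small because `[b, H] ∈ 𝒦(X, B)`, the
latter by the choice of gaps. -/
theorem tendsto_commutator_of_forall_isHigson [ProperSpace X] (hp : p ≠ ∞) (x₀ : X)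
    {B : Set (Lp E p μ →L[ℂ] Lp E p μ)} {b : Lp E p μ →L[ℂ] Lp E p μ}
    (hb : ∀ g : X →ᵇ ℂ, IsHigson g → b * rho E p μ g - rho E p μ g * b ∈ KIdeal B)
    {f : ℕ → X →ᵇ ℂ} (hf : IsVeryLipschitz f) :
    Tendsto (fun n => ‖b * rho E p μ (f n) - rho E p μ (f n) * b‖) atTop (𝓝 0) := by
  obtain ⟨⟨C₀, hC₀⟩, hlip⟩ := hf
  have hC₀0 : 0 ≤ C₀ := (norm_nonneg _).trans (hC₀ 0)
  by_contra hcon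
  obtain ⟨ε, hε, hbig⟩ : ∃ ε > 0,
      ∃ᶠ n in atTop, ε ≤ ‖b * rho E p μ (f n) - rho E p μ (f n) * b‖ := by
    rw [Metric.tendsto_nhds] at hcon
    push Not at hcon
    obtain ⟨ε, hε, h⟩ := hcon
    refine ⟨ε, hε, h.mono fun n hn => ?_⟩
    rw [dist_zero_right, norm_norm] at hn
    exact hn
  set D : ℝ := 2 * C₀ + 1 with hD
  have hD0 : 0 < D := by positivity
  set δ : ℝ := ε / (16 * D) with hδ
  have hδ0 : 0 < δ := by positivity
  choose e he using fun r : ℝ => exists_isCutoff x₀ r one_pos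
  choose s hs hsmall using fun r : ℝ =>
    exists_radius_of_commutator_mem_KIdeal hb hD0 hδ0 (he r)
  have hs1 : ∀ r, r + 1 ≤ s r := fun r => by simpa using hs r
  -- The guard `0 ≤ r` lets the choice range over all real `r`; the values `0, 0` for negative `r`
  -- are never used.
  have hloc : ∀ (r : ℝ) (k : ℕ), ∃ (g : X →ᵇ ℂ) (t : ℝ), 0 ≤ r → s r ≤ t ∧ ‖g‖ ≤ D ∧
      LipschitzWith (1 / ((k : ℝ≥0) + 1)) g ∧ (∀ x, dist x x₀ ≤ s r → g x = 0) ∧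
      (∀ x, t ≤ dist x x₀ → g x = 0) ∧ ε / 2 < ‖b * rho E p μ g - rho E p μ g * b‖ := by
    intro r k
    by_cases hr : 0 ≤ r
    · obtain ⟨g, t, h1, h2, h3, h4, h5, h6⟩ := exists_localized_commutator hp x₀ (C := ⟨C₀, hC₀0⟩)
        hC₀ hlip hε hbig (r := s r) (by linarith [hs1 r])
        (lam := 1 / ((k : ℝ≥0) + 1)) (by positivity)
      refine ⟨g, t, fun _ => ⟨h1, h2.trans ?_, h3, h4, h5, h6⟩⟩
      change 2 * C₀ ≤ D
      linarith
    · exact ⟨0, 0, fun h => absurd h hr⟩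
  choose G t hG using hloc
  -- The order of radii is `r k < s (r k) ≤ t < s t < r (k + 1)`, with `g k` supported between `s (r
  -- k)` and `t`. The two steps by `s` are the gaps inside and outside that support; the final `+ 1`
  -- leaves room for the ramp of the outer cutoff.
  let r : ℕ → ℝ := fun k => Nat.rec 0 (fun k r => s (t r k) + 1) k
  have hr_succ : ∀ k, r (k + 1) = s (t (r k) k) + 1 := fun k => rfl
  have hrk : ∀ k : ℕ, (k : ℝ) ≤ r k := by
    intro k
    induction k with
    | zero => exact le_of_eq Nat.cast_zero
    | succ k ih =>
      have h0 : 0 ≤ r k := (Nat.cast_nonneg k).trans ih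
      have := (hG (r k) k h0).1
      rw [hr_succ]
      push_cast
      linarith [hs1 (r k), hs1 (t (r k) k)]
  have hr0 : ∀ k, 0 ≤ r k := fun k => (Nat.cast_nonneg k).trans (hrk k)
  have hstep : ∀ k, r k + 1 ≤ s (r k) ∧ s (r k) ≤ t (r k) k ∧
      t (r k) k + 1 ≤ s (t (r k) k) ∧ s (t (r k) k) + 1 = r (k + 1) := fun k =>
    ⟨hs1 _, (hG (r k) k (hr0 k)).1, hs1 _, rfl⟩
  have hmono : Monotone r := monotone_nat_of_le_succ fun k => by
    obtain ⟨h1, h2, h3, h4⟩ := hstep k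
    linarith
  let g : ℕ → X →ᵇ ℂ := fun k => G (r k) k
  have hgsupp : ∀ k x, g k x ≠ 0 → s (r k) < dist x x₀ ∧ dist x x₀ < t (r k) k := by
    intro k x hx
    obtain ⟨-, -, -, h4, h5, -⟩ := hG (r k) k (hr0 k)
    exact ⟨not_le.1 fun h => hx (h4 x h), not_le.1 fun h => hx (h5 x h)⟩
  obtain ⟨H, hH, hHg⟩ := exists_isHigson_glue x₀ hrk hmono (D := D) (g := g)
    (fun k => (hG (r k) k (hr0 k)).2.1) (fun k => (hG (r k) k (hr0 k)).2.2.1)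
    (fun k x hx => by
      obtain ⟨h1, h2, h3, h4⟩ := hstep k
      obtain ⟨h5, h6⟩ := hgsupp k x hx
      constructor <;> linarith)
  obtain ⟨ρ, hρ⟩ := exists_radius_of_mem_KIdeal x₀ (hb H hH) (D := 2) (by norm_num) hδ0
  obtain ⟨k, hk⟩ := exists_nat_gt ρ
  obtain ⟨h1, h2, h3, h4⟩ := hstep k
  obtain ⟨-, hgD, -, hg0, hgt, hgbig⟩ := hG (r k) k (hr0 k)
  set u := s (t (r k) k) with hu
  have hsupp_e : ∀ a x, a + 1 ≤ dist x x₀ → e a x = 0 := fun a x hx =>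
    (he a).eq_zero x (by simpa using hx)
  let h : X →ᵇ ℂ := e u - e (r k)
  have hhx : ∀ x, h x = e u x - e (r k) x := fun x => rfl
  have hgh : h * g k = g k := by
    ext x
    by_cases hx : g k x = 0
    · rw [BoundedContinuousFunction.mul_apply, hx, mul_zero]
    · obtain ⟨h5, h6⟩ := hgsupp k x hx
      rw [BoundedContinuousFunction.mul_apply, hhx, (he u).eq_one x (by linarith),
        hsupp_e _ x (by linarith), sub_zero, one_mul]
  have hHh : h * H = g k := by
    rw [← hgh]
    ext x
    rw [BoundedContinuousFunction.mul_apply, BoundedContinuousFunction.mul_apply]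
    rcases le_total (dist x x₀) (r k) with hx | hx
    · rw [hhx, (he u).eq_one x (by linarith), (he _).eq_one x hx, sub_self, zero_mul, zero_mul]
    rcases le_total (dist x x₀) (r (k + 1)) with hx' | hx'
    · rw [hHg k x hx hx']
    · rw [hhx, hsupp_e _ x (by linarith), hsupp_e _ x (by linarith), sub_self, zero_mul, zero_mul]
  have hh2 : ‖h‖ ≤ 2 := by
    refine (norm_sub_le _ _).trans ?_
    linarith [(he u).norm_le, (he (r k)).norm_le]
  have hKsmall : ‖(b * rho E p μ H - rho E p μ H * b) * rho E p μ h‖ ≤ δ := by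
    refine (hρ h hh2 fun x hx => ?_).1
    have : dist x x₀ ≤ r k := by linarith [hrk k]
    rw [hhx, (he u).eq_one x (by linarith), (he _).eq_one x this, sub_self]
  have hnear := hsmall (r k) (g k) hgD hg0
  have hfar := hsmall (t (r k) k) (1 - e u) ((he u).norm_one_sub_le.trans (by linarith))
    fun x hx => by
      change 1 - e u x = 0
      rw [(he u).eq_one x hx, sub_self]
  have het : e (t (r k) k) * g k = g k := by
    ext x
    rw [BoundedContinuousFunction.mul_apply]
    by_cases hx : g k x = 0
    · rw [hx, mul_zero]
    · rw [(he _).eq_one x (hgsupp k x hx).2.le, one_mul]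
  -- This is the identity `1 = h + e (r k) + (1 - e u)` inserted next to `b` on the side away from
  -- `g k`. The three lines contribute at most `2δ`, `2δ` and `2δD`, in total at most `3ε / 8 < ε /
  -- 2`.
  have hdec : b * rho E p μ (g k) - rho E p μ (g k) * b =
      rho E p μ h * ((b * rho E p μ H - rho E p μ H * b) * rho E p μ h) +
      (rho E p μ (e (r k)) * b * rho E p μ (g k) - rho E p μ (g k) * b * rho E p μ (e (r k))) +
      (rho E p μ (1 - e u) * b * rho E p μ (e (t (r k) k)) * rho E p μ (g k) -
        rho E p μ (g k) * (rho E p μ (e (t (r k) k)) * b * rho E p μ (1 - e u))) := by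
    have e1 : rho E p μ H * rho E p μ h = rho E p μ (g k) := by rw [← rho_mul, mul_comm, hHh]
    have e2 : rho E p μ h * rho E p μ H = rho E p μ (g k) := by rw [← rho_mul, hHh]
    have e3 : rho E p μ (e (t (r k) k)) * rho E p μ (g k) = rho E p μ (g k) := by
      rw [← rho_mul, het]
    have e4 : rho E p μ (g k) * rho E p μ (e (t (r k) k)) = rho E p μ (g k) := by
      rw [← rho_mul, mul_comm, het]
    have e5 : rho E p μ h * ((b * rho E p μ H - rho E p μ H * b) * rho E p μ h) =
        rho E p μ h * b * rho E p μ (g k) - rho E p μ (g k) * b * rho E p μ h := by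
      rw [sub_mul, mul_sub, mul_assoc b, e1, ← mul_assoc, ← mul_assoc, ← mul_assoc, e2]
    have e6 : rho E p μ (1 - e u) * b * rho E p μ (e (t (r k) k)) * rho E p μ (g k) =
        rho E p μ (1 - e u) * b * rho E p μ (g k) := by rw [mul_assoc, e3]
    have e7 : rho E p μ (g k) * (rho E p μ (e (t (r k) k)) * b * rho E p μ (1 - e u)) =
        rho E p μ (g k) * b * rho E p μ (1 - e u) := by rw [← mul_assoc, ← mul_assoc, e4]
    rw [e5, e6, e7, rho_sub, rho_sub, rho_one]
    noncomm_ring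
  have hδD : δ * D = ε / 16 := by
    rw [hδ]
    field_simp
  have hδε : δ ≤ ε / 16 := by
    rw [← hδD]
    exact le_mul_of_one_le_right hδ0.le (by linarith)
  have b1 := norm_rho_mul_le h hh2 ((b * rho E p μ H - rho E p μ H * b) * rho E p μ h)
  have b2 := norm_sub_le (rho E p μ (e (r k)) * b * rho E p μ (g k))
    (rho E p μ (g k) * b * rho E p μ (e (r k)))
  have b3 := norm_sub_le (rho E p μ (1 - e u) * b * rho E p μ (e (t (r k) k)) * rho E p μ (g k))
    (rho E p μ (g k) * (rho E p μ (e (t (r k) k)) * b * rho E p μ (1 - e u)))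
  have b4 := (norm_mul_rho_le (g k) hgD (rho E p μ (1 - e u) * b * rho E p μ (e (t (r k) k)))).trans
    (mul_le_mul_of_nonneg_right hfar.2 hD0.le)
  have b5 := (norm_rho_mul_le (g k) hgD (rho E p μ (e (t (r k) k)) * b * rho E p μ (1 - e u))).trans
    (mul_le_mul_of_nonneg_left hfar.1 hD0.le)
  have b6 := norm_add_le (rho E p μ h * ((b * rho E p μ H - rho E p μ H * b) * rho E p μ h) +
      (rho E p μ (e (r k)) * b * rho E p μ (g k) - rho E p μ (g k) * b * rho E p μ (e (r k))))
      (rho E p μ (1 - e u) * b * rho E p μ (e (t (r k) k)) * rho E p μ (g k) -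
        rho E p μ (g k) * (rho E p μ (e (t (r k) k)) * b * rho E p μ (1 - e u)))
  have b7 := norm_add_le (rho E p μ h * ((b * rho E p μ H - rho E p μ H * b) * rho E p μ h))
      (rho E p μ (e (r k)) * b * rho E p μ (g k) - rho E p μ (g k) * b * rho E p μ (e (r k)))
  have hgbig' : ε / 2 < ‖b * rho E p μ (g k) - rho E p μ (g k) * b‖ := hgbig
  rw [hdec] at hgbig'
  rw [mul_comm D δ] at b5
  linarith [hnear.1, hnear.2]

end HigsonConverse

/-! ### Averaging over signs -/

/-- The parallelogram identity says that averaging over the sign of one summand removes its cross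
terms with the rest. Removing the summands one at a time bounds the diagonal part of `Q` by its
values on signed sums, with no loss depending on the number of summands. -/
theorem norm_add_sum_le_of_signs {ι V W : Type*} [AddCommGroup V] [Module ℝ V]
    [NormedAddCommGroup W] [NormedSpace ℂ W] {Q : V → W}
    (hQ : ∀ w v, Q (w + v) + Q (w - v) = (2 : ℂ) • (Q w + Q v)) (ψ : ι → V) {ε : ℝ}
    (F : Finset ι) (w : V)
    (h : ∀ σ : ι → ℝ, (∀ i, |σ i| = 1) → ‖Q (w + ∑ i ∈ F, σ i • ψ i)‖ ≤ ε) :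
    ‖Q w + ∑ i ∈ F, Q (ψ i)‖ ≤ ε := by
  classical
  induction F using Finset.induction_on generalizing w with
  | empty => simpa using h (fun _ => 1) (by simp)
  | insert a F ha ih =>
    have key : ∀ s : ℝ, |s| = 1 → ‖Q (w + s • ψ a) + ∑ i ∈ F, Q (ψ i)‖ ≤ ε := by
      intro s hs
      refine ih _ fun σ hσ => ?_
      have h2 := h (Function.update σ a s) fun i => by
        by_cases hi : i = a
        · rw [hi, Function.update_self, hs]
        · rw [Function.update_of_ne hi, hσ]
      rw [Finset.sum_insert ha, Function.update_self, ← add_assoc,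
        Finset.sum_congr rfl fun i hi => by
          rw [Function.update_of_ne (by rintro rfl; exact ha hi)]] at h2
      exact h2
    have h1 := key 1 (by simp)
    have h2 := key (-1) (by simp)
    rw [one_smul] at h1
    rw [neg_one_smul, ← sub_eq_add_neg] at h2
    have h3 : (2 : ℂ) • (Q w + ∑ i ∈ insert a F, Q (ψ i)) =
        (Q (w + ψ a) + ∑ i ∈ F, Q (ψ i)) + (Q (w - ψ a) + ∑ i ∈ F, Q (ψ i)) := by
      rw [Finset.sum_insert ha, ← add_assoc, smul_add, ← hQ, two_smul]
      abel
    have h4 := (norm_add_le _ _).trans (add_le_add h1 h2)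
    rw [← h3, norm_smul, Complex.norm_two] at h4
    linarith

/-! ### Adapted families of functions -/

section Adapted

variable {X : Type u} [MetricSpace X]

theorem tsupport_toC (f : X →ᵇ ℝ) : tsupport (toC f) = tsupport f := by
  have : Function.support (toC f) = Function.support f := by
    ext x
    simp
  rw [tsupport, tsupport, this]

/-- A family of equi-Lipschitz functions with disjoint supports, each of which is supported in the
`t`-neighbourhood of a member of `𝒴`. -/
structure IsAdapted (𝒴 : Set (Set X)) (t : ℝ) {J : Type u} (e : J → X →ᵇ ℝ) : Prop where
  nonneg : ∀ j x, 0 ≤ e j x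
  le_one : ∀ j x, e j x ≤ 1
  lipschitz : ∃ M : ℝ≥0, ∀ j, LipschitzWith M (e j)
  disjoint_tsupport : ∀ i j, i ≠ j → Disjoint (tsupport (e i)) (tsupport (e j))
  exists_mem : ∀ j, ∃ Z ∈ 𝒴, ∀ x, e j x ≠ 0 → ∃ y ∈ Z, dist x y < t

variable {𝒴 : Set (Set X)} {t : ℝ} {J : Type u} {e : J → X →ᵇ ℝ}

theorem norm_toC_le_one {f : X →ᵇ ℝ} (h0 : ∀ x, 0 ≤ f x) (h1 : ∀ x, f x ≤ 1) : ‖toC f‖ ≤ 1 :=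
  norm_toC_le zero_le_one fun x => by rw [abs_of_nonneg (h0 x)]; exact h1 x

theorem norm_le_one_of_mem {f : X →ᵇ ℝ} (h0 : ∀ x, 0 ≤ f x) (h1 : ∀ x, f x ≤ 1) : ‖f‖ ≤ 1 :=
  (BoundedContinuousFunction.norm_le zero_le_one).2 fun x => by
    rw [Real.norm_eq_abs, abs_of_nonneg (h0 x)]
    exact h1 x

theorem IsAdapted.isCutdownFamily (he : IsAdapted 𝒴 t e) : IsCutdownFamily fun j => toC (e j) where
  uniformEquicontinuous := by
    obtain ⟨M, hM⟩ := he.lipschitz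
    exact LipschitzWith.uniformEquicontinuous _ M fun j => lipschitzWith_toC (hM j)
  nonneg j x := by
    rw [toC_apply]
    exact_mod_cast he.nonneg j x
  norm_le_one j := norm_toC_le_one (he.nonneg j) (he.le_one j)
  disjoint_support i j hij := by
    rw [tsupport_toC, tsupport_toC]
    exact he.disjoint_tsupport i j hij

theorem mul_eq_zero_of_disjoint_tsupport {f g : X →ᵇ ℝ} (h : Disjoint (tsupport f) (tsupport g)) :
    f * g = 0 := by
  ext x
  rw [BoundedContinuousFunction.mul_apply]
  by_contra hx
  have hx' : f x * g x ≠ 0 := hx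
  exact Set.disjoint_left.1 h (subset_tsupport _ (left_ne_zero_of_mul hx'))
    (subset_tsupport _ (right_ne_zero_of_mul hx'))

theorem IsAdapted.pairwise_mul_eq_zero (he : IsAdapted 𝒴 t e) :
    Pairwise fun i j => toC (e i) * toC (e j) = 0 := by
  intro i j hij
  rw [← toC_mul, mul_eq_zero_of_disjoint_tsupport (he.disjoint_tsupport i j hij)]
  ext x
  simp

/-- A signed finite sum of `L`-Lipschitz functions with disjoint supports is `2L`-Lipschitz. -/
theorem lipschitzWith_sum_smul {ι : Type*} {ψ : ι → X →ᵇ ℝ} {L : ℝ≥0}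
    (hlip : ∀ i, LipschitzWith L (ψ i)) (hψ : ∀ i j, i ≠ j → ψ i * ψ j = 0) {σ : ι → ℝ}
    (hσ : ∀ i, |σ i| = 1) (F : Finset ι) :
    LipschitzWith (2 * L) (∑ i ∈ F, σ i • ψ i : X →ᵇ ℝ) := by
  classical
  refine LipschitzWith.of_dist_le_mul fun x y => ?_
  have hcard : ∀ z, ((F.filter fun i => ψ i z ≠ 0).card : ℝ) ≤ 1 := by
    intro z
    have : (F.filter fun i => ψ i z ≠ 0).card ≤ 1 := by
      refine Finset.card_le_one.2 fun i hi j hj => ?_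
      by_contra hij
      have h := DFunLike.congr_fun (hψ i j hij) z
      exact mul_ne_zero (Finset.mem_filter.1 hi).2 (Finset.mem_filter.1 hj).2 h
    exact_mod_cast this
  have hterm : ∀ i ∈ F, |σ i * ψ i x - σ i * ψ i y| ≤
      (if ψ i x ≠ 0 then L * dist x y else 0) + if ψ i y ≠ 0 then L * dist x y else 0 := by
    intro i _
    have h := (hlip i).dist_le_mul x y
    rw [← mul_sub, abs_mul, hσ, one_mul, ← Real.dist_eq]
    have h0 : 0 ≤ L * dist x y := by positivity
    split_ifs with hx hy hy
    · linarith
    · linarith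
    · linarith
    · rw [not_not.1 hx, not_not.1 hy, dist_self, add_zero]
  rw [Real.dist_eq]
  simp only [BoundedContinuousFunction.coe_sum, Finset.sum_apply]
  change |∑ i ∈ F, σ i * ψ i x - ∑ i ∈ F, σ i * ψ i y| ≤ _
  rw [← Finset.sum_sub_distrib]
  refine (Finset.abs_sum_le_sum_abs _ _).trans ((Finset.sum_le_sum hterm).trans ?_)
  -- At most one summand is nonzero at `x` and at most one at `y`, hence the factor `2`.
  rw [Finset.sum_add_distrib, ← Finset.sum_filter, ← Finset.sum_filter, Finset.sum_const,
    Finset.sum_const, nsmul_eq_mul, nsmul_eq_mul]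
  have h0 : 0 ≤ L * dist x y := by positivity
  have h1 := mul_le_mul_of_nonneg_right (hcard x) h0
  have h2 := mul_le_mul_of_nonneg_right (hcard y) h0
  push_cast
  linarith

theorem abs_sum_smul_le {ι : Type*} {ψ : ι → X →ᵇ ℝ} (h1 : ∀ i x, |ψ i x| ≤ 1)
    (hψ : ∀ i j, i ≠ j → ψ i * ψ j = 0) {σ : ι → ℝ} (hσ : ∀ i, |σ i| = 1) (F : Finset ι) (x : X) :
    |(∑ i ∈ F, σ i • ψ i : X →ᵇ ℝ) x| ≤ 1 := by
  simp only [BoundedContinuousFunction.coe_sum, Finset.sum_apply]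
  change |∑ i ∈ F, σ i * ψ i x| ≤ 1
  by_cases hx : ∃ i ∈ F, ψ i x ≠ 0
  · obtain ⟨i, hi, hix⟩ := hx
    rw [Finset.sum_eq_single_of_mem i hi, abs_mul, hσ, one_mul]
    · exact h1 i x
    · intro j _ hj
      have h := DFunLike.congr_fun (hψ i j hj.symm) x
      rw [(mul_eq_zero.1 h).resolve_left hix, mul_zero]
  · push Not at hx
    rw [Finset.sum_eq_zero fun i hi => by rw [hx i hi, mul_zero], abs_zero]
    exact zero_le_one

/-- The bump functions used to split the neighbourhood of a set `Z` along a decomposition of `Z`. -/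
theorem exists_splitting {R : ℝ} {Z : Set X} {L : ℝ≥0} (hL : 0 < L)
    (hR : 2 * (t + 2 / L) + 1 ≤ R) (hZ : SetRDecomposes R Z 𝒴) :
    ∃ (k : Fin 2 → X →ᵇ ℝ) (A : Fin 2 → Set (Set X)) (ψ : ∀ a, A a → X →ᵇ ℝ),
      (∀ a x, 0 ≤ k a x) ∧ (∀ a x, k a x ≤ 1) ∧ (∀ a, LipschitzWith (2 * L) (k a)) ∧
      (k 0 * k 0 + k 1 * k 1 = 1) ∧ (∀ a, A a ⊆ 𝒴) ∧
      (∀ a V x, 0 ≤ ψ a V x) ∧ (∀ a V x, ψ a V x ≤ 1) ∧ (∀ a V, LipschitzWith L (ψ a V)) ∧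
      (∀ a (V : A a) x, ψ a V x ≠ 0 → ∃ y ∈ V.1, dist x y < t + 2 / L) ∧
      (∀ a V V', V ≠ V' → Disjoint (tsupport (ψ a V)) (tsupport (ψ a V'))) ∧
      (∀ a, LocallyFinite fun V => Function.support (ψ a V)) ∧
      ∀ a x, (∃ z ∈ Z, dist x z < t) → k a x ≠ 0 → ∃ V, ψ a V x = 1 := by
  obtain ⟨A₀, hA₀, A₁, hA₁, hd₀, hd₁, hZ⟩ := hZ
  have hL2 : (2 : ℝ) / L = 1 / L + 1 / L := by ring
  let A : Fin 2 → Set (Set X) := ![A₀, A₁]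
  have hA : ∀ a, A a ⊆ 𝒴 := by
    intro a
    fin_cases a
    · exact hA₀
    · exact hA₁
  have hd : ∀ a, RDisjoint R (A a) := by
    intro a
    fin_cases a
    · exact hd₀
    · exact hd₁
  -- The ramp of `φ` ends within `t + 1 / L` of `⋃₀ A₀`, exactly where the bumps `ψ 0 V` are still
  -- `1`. The bumps need a further `1 / L` to decay, and the `+ 1` in the bound on `R` keeps their
  -- closed supports apart.
  obtain ⟨φ, hφ0, hφ1, hφlip, hφone, hφsupp⟩ := exists_bump (⋃₀ A₀) t hL
  choose ψ hψ0 hψ1 hψlip hψone hψsupp using fun (a : Fin 2) (V : A a) =>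
    exists_bump V.1 (t + 1 / L) hL
  have hψsupp' : ∀ a (V : A a) x, ψ a V x ≠ 0 → ∃ y ∈ V.1, dist x y < t + 2 / L := by
    intro a V x hx
    rw [hL2, ← add_assoc]
    exact hψsupp a V x hx
  have hfar : ∀ a (V V' : A a), V ≠ V' → ∀ v ∈ V.1, ∀ v' ∈ V'.1, R < dist v v' :=
    fun a V V' hne v hv v' hv' => lt_dist_of_lt_setDist
      (hd a V.1 V.2 V'.1 V'.2 fun h => hne (Subtype.ext h)) hv hv'
  -- Sine and cosine give a quadratic partition of unity that stays Lipschitz; `π / 2 ≤ 2` explains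
  -- the constant `2 * L`.
  let ks : X →ᵇ ℝ := BoundedContinuousFunction.ofNormedAddCommGroup
    (fun x => Real.sin (Real.pi / 2 * φ x)) (by fun_prop) 1 fun x => Real.abs_sin_le_one _
  let kc : X →ᵇ ℝ := BoundedContinuousFunction.ofNormedAddCommGroup
    (fun x => Real.cos (Real.pi / 2 * φ x)) (by fun_prop) 1 fun x => Real.abs_cos_le_one _
  have hlin : LipschitzWith (2 * L) fun x => Real.pi / 2 * φ x := by
    refine LipschitzWith.of_dist_le_mul fun x y => ?_
    have h := hφlip.dist_le_mul x y
    rw [Real.dist_eq] at h ⊢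
    rw [← mul_sub, abs_mul, abs_of_pos (by positivity)]
    push_cast
    rw [mul_assoc]
    gcongr
    linarith [Real.pi_le_four]
  have hang : ∀ x, 0 ≤ Real.pi / 2 * φ x ∧ Real.pi / 2 * φ x ≤ Real.pi / 2 := fun x =>
    ⟨mul_nonneg (by positivity) (hφ0 x), mul_le_of_le_one_right (by positivity) (hφ1 x)⟩
  refine ⟨![ks, kc], A, ψ, ?_, ?_, ?_, ?_, hA, hψ0, hψ1, hψlip, hψsupp', ?_, ?_, ?_⟩
  · intro a x
    have := hang x
    fin_cases a
    · exact Real.sin_nonneg_of_nonneg_of_le_pi this.1 (by linarith [Real.pi_pos])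
    · exact Real.cos_nonneg_of_neg_pi_div_two_le_of_le (by linarith [Real.pi_pos]) this.2
  · intro a x
    fin_cases a
    · exact Real.sin_le_one _
    · exact Real.cos_le_one _
  · intro a
    fin_cases a
    · have h := Real.lipschitzWith_sin.comp hlin
      rw [one_mul] at h
      exact h
    · have h := Real.lipschitzWith_cos.comp hlin
      rw [one_mul] at h
      exact h
  · ext x
    change Real.sin (Real.pi / 2 * φ x) * Real.sin (Real.pi / 2 * φ x) +
      Real.cos (Real.pi / 2 * φ x) * Real.cos (Real.pi / 2 * φ x) = 1
    rw [← sq, ← sq, Real.sin_sq_add_cos_sq]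
  · intro a V V' hne
    have hnear : ∀ (V : A a) x, x ∈ tsupport (ψ a V) →
        ∃ v ∈ V.1, dist x v < t + 2 / L + 1 / 2 := by
      intro V x hx
      obtain ⟨y, hy, hxy⟩ := Metric.mem_closure_iff.1 hx (1 / 2) (by norm_num)
      obtain ⟨v, hv, hyv⟩ := hψsupp' a V y hy
      exact ⟨v, hv, by linarith [dist_triangle x y v]⟩
    refine Set.disjoint_left.2 fun x hx hx' => ?_
    obtain ⟨v, hv, hxv⟩ := hnear V x hx
    obtain ⟨v', hv', hxv'⟩ := hnear V' x hx'
    linarith [hfar a V V' hne v hv v' hv', dist_triangle_left v v' x]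
  · intro a x
    refine ⟨Metric.ball x (1 / 2), Metric.ball_mem_nhds x (by norm_num),
      Set.Subsingleton.finite ?_⟩
    rintro V ⟨y, hy, hyx⟩ V' ⟨y', hy', hyx'⟩
    by_contra hne
    obtain ⟨v, hv, hyv⟩ := hψsupp' a V y hy
    obtain ⟨v', hv', hyv'⟩ := hψsupp' a V' y' hy'
    rw [Metric.mem_ball] at hyx hyx'
    linarith [hfar a V V' hne v hv v' hv', dist_triangle_left v v' y, dist_triangle y y' v',
      dist_triangle_right y y' x]
  · rintro a x ⟨z, hz, hxz⟩ hk
    fin_cases a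
    · have hφ : φ x ≠ 0 := fun h => hk (by
        change Real.sin (Real.pi / 2 * φ x) = 0
        rw [h, mul_zero, Real.sin_zero])
      obtain ⟨y, ⟨V, hV, hy⟩, hxy⟩ := hφsupp x hφ
      exact ⟨⟨V, hV⟩, hψone 0 ⟨V, hV⟩ x y hy hxy.le⟩
    -- Where the cosine is nonzero, `φ ≠ 1`, so the nearby point of `Z` cannot lie in `⋃₀ A₀` and
    -- must lie in a member of `A₁`.
    · rw [hZ] at hz
      rcases hz with hz | ⟨V, hV, hz⟩
      · refine absurd ?_ hk
        change Real.cos (Real.pi / 2 * φ x) = 0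
        rw [hφone x z hz hxz.le, mul_one, Real.cos_pi_div_two]
      · refine ⟨⟨V, hV⟩, hψone 1 ⟨V, hV⟩ x z hz ?_⟩
        have : (0 : ℝ) ≤ 1 / L := by positivity
        linarith

end Adapted

/-! ### Decomposing quasi-local operators -/

section Decomposition

variable {X : Type u} [MetricSpace X] [MeasurableSpace X] [BorelSpace X]
  {E : Type v} [NormedAddCommGroup E] [NormedSpace ℂ E]
  {p : ℝ≥0∞} {μ : Measure X} [Fact (1 ≤ p)]

variable (E p μ) in
/-- Multiplication by real functions. -/
noncomputable def rhoR (f : X →ᵇ ℝ) : Lp E p μ →L[ℂ] Lp E p μ := rho E p μ (toC f)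

theorem rhoR_mul (f g : X →ᵇ ℝ) : rhoR E p μ (f * g) = rhoR E p μ f * rhoR E p μ g := by
  rw [rhoR, toC_mul, rho_mul, rhoR, rhoR]

theorem rhoR_add (f g : X →ᵇ ℝ) : rhoR E p μ (f + g) = rhoR E p μ f + rhoR E p μ g := by
  rw [rhoR, toC_add, rho_add, rhoR, rhoR]

theorem rhoR_sub (f g : X →ᵇ ℝ) : rhoR E p μ (f - g) = rhoR E p μ f - rhoR E p μ g := by
  rw [rhoR, toC_sub, rho_sub, rhoR, rhoR]

theorem rhoR_one : rhoR E p μ (1 : X →ᵇ ℝ) = 1 := by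
  rw [rhoR, toC_one, rho_one]

theorem rhoR_zero : rhoR E p μ (0 : X →ᵇ ℝ) = 0 := by
  have := rhoR_sub (E := E) (p := p) (μ := μ) (0 : X →ᵇ ℝ) 0
  rwa [sub_self, sub_self] at this

theorem rhoR_sum {ι : Type*} (s : Finset ι) (f : ι → X →ᵇ ℝ) :
    rhoR E p μ (∑ i ∈ s, f i) = ∑ i ∈ s, rhoR E p μ (f i) :=
  map_sum (AddMonoidHom.mk' (rhoR E p μ) rhoR_add) f s

/-- The quadratic map `Q w = b w² - w b w = [b, w] w` is small on every signed sum of the `ψ i`,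
because such a sum is a `2L`-Lipschitz contraction. Averaging over signs leaves `∑ Q (ψ i)`. -/
theorem norm_sq_sub_block_le {b : Lp E p μ →L[ℂ] Lp E p μ} {L : ℝ≥0} {ε : ℝ}
    (hmod : ∀ h : X →ᵇ ℂ, ‖h‖ ≤ 1 → LipschitzWith (2 * L) h →
      ‖b * rho E p μ h - rho E p μ h * b‖ ≤ ε) {ι : Type*} {ψ : ι → X →ᵇ ℝ}
    (h1 : ∀ i x, |ψ i x| ≤ 1) (hlip : ∀ i, LipschitzWith L (ψ i))
    (hψ : ∀ i j, i ≠ j → ψ i * ψ j = 0) (F : Finset ι) :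
    ‖b * rhoR E p μ (∑ i ∈ F, ψ i * ψ i) - ∑ i ∈ F, rhoR E p μ (ψ i) * b * rhoR E p μ (ψ i)‖ ≤
      ε := by
  let Q : (X →ᵇ ℝ) → Lp E p μ →L[ℂ] Lp E p μ := fun w =>
    b * (rhoR E p μ w * rhoR E p μ w) - rhoR E p μ w * b * rhoR E p μ w
  have hQ : ∀ w v, Q (w + v) + Q (w - v) = (2 : ℂ) • (Q w + Q v) := by
    intro w v
    simp only [Q, rhoR_add, rhoR_sub, two_smul]
    noncomm_ring
  have key := norm_add_sum_le_of_signs hQ ψ F 0 (ε := ε) fun σ hσ => by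
    rw [zero_add]
    set S : X →ᵇ ℝ := ∑ i ∈ F, σ i • ψ i with hS
    have hS1 : ‖toC S‖ ≤ 1 := norm_toC_le zero_le_one fun x => abs_sum_smul_le h1 hψ hσ F x
    have h2 := hmod (toC S) hS1 (lipschitzWith_toC (lipschitzWith_sum_smul hlip hψ hσ F))
    have h3 : Q S = (b * rho E p μ (toC S) - rho E p μ (toC S) * b) * rho E p μ (toC S) := by
      simp only [Q, rhoR, sub_mul, mul_assoc]
    rw [h3]
    refine (norm_mul_rho_le _ hS1 _).trans ?_
    rwa [mul_one]
  have h0 : Q 0 = 0 := by simp only [Q, rhoR_zero, mul_zero, sub_zero]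
  rw [h0, zero_add, Finset.sum_sub_distrib, ← Finset.mul_sum] at key
  rwa [rhoR_sum, Finset.sum_congr rfl fun i _ => rhoR_mul (ψ i) (ψ i)]

/-- The operators which are block cutdowns of `b` along families adapted to `𝒴`. -/
def adaptedCutdowns (b : Lp E p μ →L[ℂ] Lp E p μ) (𝒴 : Set (Set X)) (t : ℝ) :
    Set (Lp E p μ →L[ℂ] Lp E p μ) :=
  {T | ∃ (J : Type u) (e : J → X →ᵇ ℝ), IsAdapted 𝒴 t e ∧
    IsBlockCutdown (fun j => toC (e j)) b T}

/-- Inside each block, `b = (k₀² + k₁²) b` is compared with `∑ₐ kₐ (∑_V ψ_V b ψ_V) kₐ`. For each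
`a`, moving one `kₐ` across `b` costs `ε`, and so does replacing `b ∑ ψ_V²` by `∑ ψ_V b ψ_V`; this
gives `4ε` per block, and the block estimate carries it over to the whole sum. Only commutators with
`b` itself enter, although `T` is a cutdown. -/
theorem exists_adaptedCutdowns_split [ProperSpace X] [CompleteSpace E] (hp : p ≠ ∞) (x₀ : X)
    {b : Lp E p μ →L[ℂ] Lp E p μ} {L : ℝ≥0} (hL : 0 < L) {ε : ℝ} (hε : 0 ≤ ε)
    (hmod : ∀ h : X →ᵇ ℂ, ‖h‖ ≤ 1 → LipschitzWith (2 * L) h →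
      ‖b * rho E p μ h - rho E p μ h * b‖ ≤ ε) {𝒳 𝒴 : Set (Set X)} {R t : ℝ}
    (hR : 2 * (t + 2 / L) + 1 ≤ R) (hdec : RDecomposes R 𝒳 𝒴)
    {T : Lp E p μ →L[ℂ] Lp E p μ} (hT : T ∈ adaptedCutdowns b 𝒳 t) :
    ∃ T' : Fin 2 → Lp E p μ →L[ℂ] Lp E p μ, (∀ a, T' a ∈ adaptedCutdowns b 𝒴 (t + 2 / L)) ∧
      ‖T - (T' 0 + T' 1)‖ ≤ 4 * ε := by
  obtain ⟨J, e, he, hTe⟩ := hT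
  choose Z hZ hsuppZ using he.exists_mem
  choose k A ψ hk0 hk1 hklip hksq hA hψ0 hψ1 hψlip hψsupp hψdisj hψfin hone using
    fun j => exists_splitting hL hR (hdec (Z j) (hZ j))
  have hψmul : ∀ j a V V', V ≠ V' → ψ j a V * ψ j a V' = 0 := fun j a V V' h =>
    mul_eq_zero_of_disjoint_tsupport (hψdisj j a V V' h)
  let f : ∀ a : Fin 2, (Σ j, A j a) → X →ᵇ ℝ := fun a i => e i.1 * k i.1 a * ψ i.1 a i.2
  have hfx : ∀ a i x, f a i x = e i.1 x * k i.1 a x * ψ i.1 a i.2 x := fun a i x => rfl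
  have hek0 : ∀ j a x, 0 ≤ e j x * k j a x := fun j a x => mul_nonneg (he.nonneg j x) (hk0 j a x)
  have hek1 : ∀ j a x, e j x * k j a x ≤ 1 := fun j a x =>
    mul_le_one₀ (he.le_one j x) (hk0 j a x) (hk1 j a x)
  have hf : ∀ a, IsAdapted 𝒴 (t + 2 / L) (f a) := by
    intro a
    refine ⟨fun i x => mul_nonneg (hek0 _ _ x) (hψ0 _ _ _ x),
      fun i x => mul_le_one₀ (hek1 _ _ x) (hψ0 _ _ _ x) (hψ1 _ _ _ x), ?_, ?_, ?_⟩
    · obtain ⟨M, hM⟩ := he.lipschitz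
      refine ⟨(M * 1 + 1 * (2 * L)) * 1 + 1 * L, fun i => ?_⟩
      refine lipschitzWith_mul (lipschitzWith_mul (hM i.1) (hklip i.1 a) ?_ ?_) (hψlip i.1 a i.2)
        ?_ ?_
      · simpa using norm_le_one_of_mem (he.nonneg i.1) (he.le_one i.1)
      · simpa using norm_le_one_of_mem (hk0 i.1 a) (hk1 i.1 a)
      · simpa using norm_le_one_of_mem (f := e i.1 * k i.1 a) (hek0 i.1 a) (hek1 i.1 a)
      · simpa using norm_le_one_of_mem (hψ0 i.1 a i.2) (hψ1 i.1 a i.2)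
    · have hsub₁ : ∀ i, tsupport (f a i) ⊆ tsupport (e i.1) := fun i =>
        closure_mono fun x hx => left_ne_zero_of_mul (left_ne_zero_of_mul
          (show e i.1 x * k i.1 a x * ψ i.1 a i.2 x ≠ 0 from hx))
      have hsub₂ : ∀ i, tsupport (f a i) ⊆ tsupport (ψ i.1 a i.2) := fun i =>
        closure_mono fun x hx => right_ne_zero_of_mul
          (show e i.1 x * k i.1 a x * ψ i.1 a i.2 x ≠ 0 from hx)
      rintro ⟨j, V⟩ ⟨j', V'⟩ hne
      by_cases hj : j = j'
      · subst hj
        exact (hψdisj j a V V' fun h => hne (by rw [h])).mono (hsub₂ _) (hsub₂ _)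
      · exact (he.disjoint_tsupport j j' hj).mono (hsub₁ _) (hsub₁ _)
    · rintro ⟨j, V⟩
      exact ⟨V.1, hA j a V.2, fun x hx => hψsupp j a V x (right_ne_zero_of_mul
        (show e j x * k j a x * ψ j a V x ≠ 0 from hx))⟩
  choose T' hT' using fun a => exists_isBlockCutdown (E := E) (μ := μ) hp
    (hf a).pairwise_mul_eq_zero (hf a).isCutdownFamily.norm_le_one b
  refine ⟨T', fun a => ⟨_, f a, hf a, hT' a⟩, ?_⟩
  -- The sign-averaging bound concerns finite sums. On vectors supported in a ball, properness and
  -- local finiteness leave finitely many `V` in each block.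
  have hcut : ∀ (c : X →ᵇ ℂ) (r s : ℝ) (K : ℝ≥0), IsCutoff x₀ r s K c → ∀ ξ : Lp E p μ,
      ‖(T - (T' 0 + T' 1)) (rho E p μ c ξ)‖ ≤ 4 * ε * ‖rho E p μ c ξ‖ := by
    intro c r s K hc ξ
    have hcx : ∀ x, c x ≠ 0 → x ∈ Metric.closedBall x₀ s := fun x hx => by
      rw [Metric.mem_closedBall]
      by_contra! h
      exact hx (hc.eq_zero x h.le)
    let F : ∀ j a, Finset (A j a) := fun j a =>
      ((hψfin j a).finite_nonempty_inter_compact (isCompact_closedBall x₀ s)).toFinset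
    have hF : ∀ j a V x, c x ≠ 0 → ψ j a V x ≠ 0 → V ∈ F j a := fun j a V x h1 h2 =>
      (Set.Finite.mem_toFinset _).2 ⟨x, h2, hcx x h1⟩
    let M := rhoR E p μ
    let Ψ : J → Fin 2 → X →ᵇ ℝ := fun j a => ∑ V ∈ F j a, ψ j a V * ψ j a V
    let P : J → Fin 2 → Lp E p μ →L[ℂ] Lp E p μ := fun j a =>
      ∑ V ∈ F j a, M (ψ j a V) * b * M (ψ j a V)
    let D₁ : J → Fin 2 → Lp E p μ →L[ℂ] Lp E p μ := fun j a =>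
      M (k j a) * (M (k j a) * b - b * M (k j a)) + M (k j a) * (b * M (Ψ j a) - P j a) * M (k j a)
    have hknorm : ∀ j a, ‖toC (k j a)‖ ≤ 1 := fun j a => norm_toC_le_one (hk0 j a) (hk1 j a)
    have hD₁ : ∀ j a, ‖D₁ j a‖ ≤ 2 * ε := by
      intro j a
      have h1 : ‖M (k j a) * (M (k j a) * b - b * M (k j a))‖ ≤ ε := by
        refine (norm_rho_mul_le _ (hknorm j a) _).trans ?_
        rw [one_mul, norm_sub_rev]
        exact hmod _ (hknorm j a) (lipschitzWith_toC (hklip j a))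
      have h2 : ‖M (k j a) * (b * M (Ψ j a) - P j a) * M (k j a)‖ ≤ ε := by
        refine (norm_mul_rho_le _ (hknorm j a) _).trans ?_
        rw [mul_one]
        refine (norm_rho_mul_le _ (hknorm j a) _).trans ?_
        rw [one_mul]
        exact norm_sq_sub_block_le hmod
          (fun V x => by rw [abs_of_nonneg (hψ0 j a V x)]; exact hψ1 j a V x) (hψlip j a)
          (hψmul j a) (F j a)
      exact (norm_add_le _ _).trans (by linarith)
    have hD : ∀ j, ‖D₁ j 0 + D₁ j 1‖ ≤ 4 * ε := fun j =>
      (norm_add_le _ _).trans (by linarith [hD₁ j 0, hD₁ j 1])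
    have hterm : ∀ j a, ∀ V ∉ F j a,
        (rho E p μ (toC (f a ⟨j, V⟩)) * b * rho E p μ (toC (f a ⟨j, V⟩))) (rho E p μ c ξ) = 0 := by
      intro j a V hV
      have h0 : toC (f a ⟨j, V⟩) * c = 0 := by
        ext x
        change ((e j x * k j a x * ψ j a V x : ℝ) : ℂ) * c x = 0
        by_cases h1 : c x = 0
        · rw [h1, mul_zero]
        by_cases h2 : ψ j a V x = 0
        · rw [h2, mul_zero, Complex.ofReal_zero, zero_mul]
        · exact absurd (hF j a V x h1 h2) hV
      change (rho E p μ (toC (f a ⟨j, V⟩)) * b * rho E p μ (toC (f a ⟨j, V⟩)) * rho E p μ c) ξ = 0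
      rw [mul_assoc, ← rho_mul, h0, rho_zero, mul_zero]
      rfl
    have hsumV : ∀ a, HasSum (fun j => ∑ V ∈ F j a,
        (rho E p μ (toC (f a ⟨j, V⟩)) * b * rho E p μ (toC (f a ⟨j, V⟩))) (rho E p μ c ξ))
        (T' a (rho E p μ c ξ)) := fun a =>
      HasSum.sigma (hT' a (rho E p μ c ξ)) fun j => hasSum_sum_of_ne_finset_zero (hterm j a)
    have hsum := (hTe (rho E p μ c ξ)).sub ((hsumV 0).add (hsumV 1))
    have hid : ∀ j, M (e j) * (D₁ j 0 + D₁ j 1) * M (e j) * rho E p μ c =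
        M (e j) * b * M (e j) * rho E p μ c -
          ((∑ V ∈ F j 0, M (f 0 ⟨j, V⟩) * b * M (f 0 ⟨j, V⟩) * rho E p μ c) +
            ∑ V ∈ F j 1, M (f 1 ⟨j, V⟩) * b * M (f 1 ⟨j, V⟩) * rho E p μ c) := by
      intro j
      -- Where `c`, `e j` and `k j a` are all nonzero, one bump `ψ j a V` equals `1` and the others
      -- vanish, so multiplying by `Ψ j a` changes nothing.
      have hΨ : ∀ a, M (Ψ j a) * M (k j a) * M (e j) * rho E p μ c =
          M (k j a) * M (e j) * rho E p μ c := by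
        intro a
        change rho E p μ _ * rho E p μ _ * rho E p μ _ * rho E p μ c = _
        simp only [M, rhoR, ← rho_mul]
        congr 1
        ext x
        by_cases h1 : c x = 0
        · simp [h1]
        by_cases h2 : e j x = 0
        · simp [h2]
        by_cases h3 : k j a x = 0
        · simp [h3]
        obtain ⟨V, hV⟩ := hone j a x (hsuppZ j x h2) h3
        have h4 : Ψ j a x = 1 := by
          simp only [Ψ, BoundedContinuousFunction.coe_sum, Finset.sum_apply,
            BoundedContinuousFunction.mul_apply]
          rw [Finset.sum_eq_single_of_mem V (hF j a V x h1 (by rw [hV]; exact one_ne_zero)), hV,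
            one_mul]
          intro V' _ hne
          have h := DFunLike.congr_fun (hψmul j a V V' hne.symm) x
          rw [BoundedContinuousFunction.mul_apply, hV, one_mul] at h
          rw [h]
          exact mul_zero _
        simp [h4]
      have hblock : ∀ a, ∑ V ∈ F j a, M (f a ⟨j, V⟩) * b * M (f a ⟨j, V⟩) * rho E p μ c =
          M (e j) * M (k j a) * P j a * M (k j a) * M (e j) * rho E p μ c := by
        intro a
        simp only [P, Finset.mul_sum, Finset.sum_mul]
        refine Finset.sum_congr rfl fun V _ => ?_
        have h1 : M (f a ⟨j, V⟩) = M (e j) * M (k j a) * M (ψ j a V) := by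
          simp only [M, ← rhoR_mul]
          rfl
        have h2 : M (f a ⟨j, V⟩) = M (ψ j a V) * M (k j a) * M (e j) := by
          simp only [M, ← rhoR_mul]
          congr 1
          change e j * k j a * ψ j a V = _
          ring
        rw [show M (f a ⟨j, V⟩) * b * M (f a ⟨j, V⟩) = _ from
          congrArg₂ (fun u v => u * b * v) h1 h2]
        simp only [mul_assoc]
      have hone' : M (k j 0) * M (k j 0) + M (k j 1) * M (k j 1) = 1 := by
        simp only [M, ← rhoR_mul, ← rhoR_add, hksq, rhoR_one]
      have hDa : ∀ a, M (e j) * D₁ j a * M (e j) * rho E p μ c =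
          M (e j) * (M (k j a) * M (k j a)) * b * M (e j) * rho E p μ c -
            M (e j) * M (k j a) * P j a * M (k j a) * M (e j) * rho E p μ c := by
        intro a
        have h1 : M (e j) * M (k j a) * b * (M (Ψ j a) * M (k j a) * M (e j) * rho E p μ c) =
            M (e j) * M (k j a) * b * (M (k j a) * M (e j) * rho E p μ c) := by rw [hΨ]
        have h2 : M (e j) * D₁ j a * M (e j) * rho E p μ c =
            M (e j) * (M (k j a) * M (k j a)) * b * M (e j) * rho E p μ c -
              M (e j) * M (k j a) * b * (M (k j a) * M (e j) * rho E p μ c) +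
              M (e j) * M (k j a) * b * (M (Ψ j a) * M (k j a) * M (e j) * rho E p μ c) -
              M (e j) * M (k j a) * P j a * M (k j a) * M (e j) * rho E p μ c := by
          simp only [D₁]
          noncomm_ring
        rw [h2, h1, sub_add_cancel]
      rw [hblock, hblock, mul_add, add_mul, add_mul, hDa, hDa, sub_add_sub_comm]
      congr 1
      rw [← add_mul, ← add_mul, ← add_mul, ← mul_add, hone', mul_one]
    refine (norm_le_of_hasSum_block hp he.pairwise_mul_eq_zero he.pairwise_mul_eq_zero zero_le_one
      zero_le_one (by positivity) he.isCutdownFamily.norm_le_one he.isCutdownFamily.norm_le_one hD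
      (η := (T - (T' 0 + T' 1)) (rho E p μ c ξ)) ?_).trans_eq (by ring)
    refine hsum.congr_fun fun j => ?_
    have h := DFunLike.congr_fun (hid j) ξ
    rw [sub_apply, add_apply, _root_.sum_apply, _root_.sum_apply] at h
    exact h
  choose c hc using fun m : ℕ => exists_isCutoff x₀ (m : ℝ) one_pos
  refine ContinuousLinearMap.opNorm_le_bound _ (by positivity) fun ξ => ?_
  have hlim := ((T - (T' 0 + T' 1)).continuous.tendsto ξ).comp (tendsto_rho_cutoff hp x₀
    (fun m => (hc m).norm_one_sub_le) (fun m => (hc m).eq_one) ξ)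
  refine le_of_tendsto hlim.norm (.of_forall fun m => (hcut (c m) _ _ _ (hc m) ξ).trans ?_)
  gcongr
  exact (norm_rho_apply_le _ (hc m).norm_le ξ).trans_eq (one_mul _)

/-- A nonzero term `f e_j b e_j f'` puts a point of each support in the `t`-neighbourhood of the
same member of `𝒴`, so the supports are at distance at most `2 * t + C`. -/
theorem adaptedCutdowns_subset {B : Set (Lp E p μ →L[ℂ] Lp E p μ)}
    (hBcut : ClosedUnderBlockCutdowns B) {b : Lp E p μ →L[ℂ] Lp E p μ} (hb : b ∈ B)
    {𝒴 : Set (Set X)} {t C : ℝ} (hC : ∀ Y ∈ 𝒴, ∀ x ∈ Y, ∀ y ∈ Y, dist x y ≤ C) :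
    ∀ T ∈ adaptedCutdowns b 𝒴 t, T ∈ B ∧ HasPropagationAtMost T (2 * t + C) := by
  rintro T ⟨J, e, he, hT⟩
  refine ⟨hBcut J _ he.isCutdownFamily b hb T hT, fun f f' hd => ?_⟩
  ext1 ξ
  have h1 := (hT (rho E p μ f' ξ)).mapL (rho E p μ f)
  refine h1.unique ?_
  refine hasSum_zero.congr_fun fun j => ?_
  by_cases hf : f * toC (e j) = 0
  · change ((rho E p μ f * rho E p μ (toC (e j))) * b * rho E p μ (toC (e j)) * rho E p μ f') ξ = 0
    rw [← rho_mul, hf, rho_zero, zero_mul, zero_mul, zero_mul]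
    rfl
  by_cases hf' : toC (e j) * f' = 0
  · change (rho E p μ f * (rho E p μ (toC (e j)) * b) * (rho E p μ (toC (e j)) * rho E p μ f')) ξ
      = 0
    rw [← rho_mul (toC (e j)), hf', rho_zero, mul_zero]
    rfl
  exfalso
  have hex : ∀ g : X →ᵇ ℂ, g ≠ 0 → ∃ x, g x ≠ 0 := fun g hg => by
    by_contra! h
    exact hg (by ext x; exact h x)
  obtain ⟨x, hx⟩ := hex _ hf
  obtain ⟨y, hy⟩ := hex _ hf'
  rw [BoundedContinuousFunction.mul_apply] at hx hy
  obtain ⟨Z, hZ, hsupp⟩ := he.exists_mem j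
  obtain ⟨z, hz, hxz⟩ := hsupp x fun h => hx (by rw [toC_apply, h]; simp)
  obtain ⟨w, hw, hyw⟩ := hsupp y fun h => hy (by rw [toC_apply, h]; simp)
  have h2 := lt_dist_of_lt_setDist hd (subset_tsupport _ (left_ne_zero_of_mul hx))
    (subset_tsupport _ (right_ne_zero_of_mul hy))
  have h3 := hC Z hZ z hz w hw
  linarith [dist_triangle4 x z w y, dist_comm y w]

theorem IsQuasiLocal.mem_Roe [ProperSpace X] [CompleteSpace E] (hp : p ≠ ∞) (x₀ : X)
    (hX : HasSFDC X) {B : NonUnitalSubalgebra ℂ (Lp E p μ →L[ℂ] Lp E p μ)}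
    (hBcut : ClosedUnderBlockCutdowns (B : Set (Lp E p μ →L[ℂ] Lp E p μ)))
    {b : Lp E p μ →L[ℂ] Lp E p μ} (hbB : b ∈ B) (hb : IsQuasiLocal b) :
    b ∈ Roe (B : Set (Lp E p μ →L[ℂ] Lp E p μ)) := by
  refine Metric.mem_closure_iff.2 fun ε hε => ?_
  -- Stage `i` involves `2 ^ i` operators, each with error `4 * ε / (16 * 4 ^ i)`, so all errors
  -- together stay below `ε / 2`.
  have hmod : ∀ i : ℕ, ∃ L : ℝ≥0, 0 < L ∧ ∀ h : X →ᵇ ℂ, ‖h‖ ≤ 1 → LipschitzWith (2 * L) h →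
      ‖b * rho E p μ h - rho E p μ h * b‖ ≤ ε / (16 * 4 ^ i) := by
    intro i
    obtain ⟨L, hL, h⟩ := hb.exists_lipschitz_modulus hp zero_lt_one
      (show 0 < ε / (16 * 4 ^ i) by positivity)
    refine ⟨L / 2, by positivity, fun h' h1 h2 => h h' h1 ?_⟩
    rwa [mul_div_cancel₀ _ two_ne_zero] at h2
  choose L hL hmod using hmod
  -- Each stage widens the neighbourhoods by `2 / L i`. The initial `1` provides the strict
  -- inequality required when the single set `X` is adapted to itself.
  let t : ℕ → ℝ := fun i => 1 + ∑ j ∈ Finset.range i, 2 / (L j : ℝ)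
  have ht_succ : ∀ i, t (i + 1) = t i + 2 / L i := fun i => by
    simp only [t, Finset.sum_range_succ, add_assoc]
  have ht0 : ∀ i, 0 ≤ t i := fun i => by positivity
  let R : ℕ → ℝ := fun i => 2 * t (i + 1) + 1 + i
  have hRmono : StrictMono R := strictMono_nat_of_lt_succ fun i => by
    have : 0 ≤ 2 / (L (i + 1) : ℝ) := by positivity
    simp only [R]
    rw [ht_succ (i + 1)]
    push_cast
    linarith
  obtain ⟨m, 𝒳, h𝒳0, hdec, C, hC⟩ := hX R (by have := ht0 1; simp only [R]; positivity) hRmono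
  have hind : ∀ d i, i + d = m → ∀ T ∈ adaptedCutdowns b (𝒳 i) (t i),
      ∃ T' ∈ B, HasPropagationAtMost T' (2 * t m + max C 0) ∧ ‖T - T'‖ ≤ ε / (2 * 4 ^ i) := by
    intro d
    induction d with
    | zero =>
      rintro i rfl T hT
      obtain ⟨h1, h2⟩ := adaptedCutdowns_subset hBcut hbB
        (fun Y hY x hx y hy => (hC Y hY x hx y hy).trans (le_max_left C 0)) T hT
      exact ⟨T, h1, h2, by rw [sub_self, norm_zero]; positivity⟩
    | succ d ih =>
      intro i hi T hT
      obtain ⟨T', hT', hTT'⟩ := exists_adaptedCutdowns_split hp x₀ (hL i)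
        (by positivity) (hmod i) (R := R i) (by
          simp only [R]
          rw [ht_succ]
          have : (0 : ℝ) ≤ i := Nat.cast_nonneg i
          linarith) (hdec i (by omega)) hT
      rw [← ht_succ] at hT'
      choose S hSB hSprop hS using fun a => ih (i + 1) (by omega) (T' a) (hT' a)
      refine ⟨S 0 + S 1, add_mem (hSB 0) (hSB 1), fun f f' hd => ?_, ?_⟩
      · rw [mul_add, add_mul, hSprop 0 f f' hd, hSprop 1 f f' hd, add_zero]
      · rw [show T - (S 0 + S 1) = (T - (T' 0 + T' 1)) + ((T' 0 - S 0) + (T' 1 - S 1)) by abel]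
        refine (norm_add_le _ _).trans ((add_le_add hTT' ((norm_add_le _ _).trans
          (add_le_add (hS 0) (hS 1)))).trans_eq ?_)
        rw [pow_succ]
        field_simp
        norm_num
  -- The recursion starts with `b` as its own cutdown, along the one-element family consisting of
  -- the constant function `1`.
  have hstart : b ∈ adaptedCutdowns b (𝒳 0) (t 0) := by
    refine ⟨PUnit, fun _ => 1, ⟨fun _ _ => zero_le_one, fun _ _ => le_rfl, ?_, ?_, ?_⟩, ?_⟩
    · exact ⟨0, fun _ => LipschitzWith.const (1 : ℝ)⟩
    · exact fun i j h => absurd (Subsingleton.elim i j) h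
    · intro _
      refine ⟨Set.univ, by rw [h𝒳0]; rfl, fun x _ => ⟨x, trivial, ?_⟩⟩
      simp [t]
    · intro ξ
      simp only [toC_one, rho_one, one_mul, mul_one]
      exact hasSum_unique _
  obtain ⟨T', hT'B, hT', hle⟩ := hind m 0 (zero_add m) b hstart
  refine ⟨T', ⟨hT'B, _, ?_, hT'⟩, ?_⟩
  · have := ht0 m
    positivity
  · rw [dist_eq_norm]
    refine hle.trans_lt ?_
    rw [pow_zero, mul_one]
    exact half_lt_self hε

end Decomposition

end RoeLike

/-! ### Assembling the equivalences. -/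

theorem mainTheorem1 {X : Type u} [MetricSpace X] [ProperSpace X]
    [MeasurableSpace X] [BorelSpace X] (μ : Measure X) [μ.Regular] [μ.IsOpenPosMeasure]
    (p : ℝ≥0∞) [Fact (1 ≤ p)] (hp : p ≠ ∞)
    {E : Type v} [NormedAddCommGroup E] [NormedSpace ℂ E] [CompleteSpace E]
    (B : NonUnitalSubalgebra ℂ (Lp E p μ →L[ℂ] Lp E p μ))
    (hBclosed : IsClosed (B : Set (Lp E p μ →L[ℂ] Lp E p μ)))
    (hBmul : RoeLike.cbMulCb (B : Set (Lp E p μ →L[ℂ] Lp E p μ)) = B)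
    (hBcut : RoeLike.ClosedUnderBlockCutdowns (B : Set (Lp E p μ →L[ℂ] Lp E p μ)))
    (b : Lp E p μ →L[ℂ] Lp E p μ) (hb : b ∈ B) :
    List.TFAE
      [∀ F ∈ RoeLike.VLInfty E p μ,
          RoeLike.SeqAlg.const b * F - F * RoeLike.SeqAlg.const b = 0,
        RoeLike.IsQuasiLocal b,
        ∀ g : BoundedContinuousFunction X ℂ, RoeLike.IsHigson g →
          b * RoeLike.rho E p μ g - RoeLike.rho E p μ g * b ∈
            RoeLike.KIdeal (B : Set (Lp E p μ →L[ℂ] Lp E p μ))] ∧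
    (RoeLike.HasSFDC X →
      List.TFAE
        [∀ F ∈ RoeLike.VLInfty E p μ,
            RoeLike.SeqAlg.const b * F - F * RoeLike.SeqAlg.const b = 0,
          RoeLike.IsQuasiLocal b,
          ∀ g : BoundedContinuousFunction X ℂ, RoeLike.IsHigson g →
            b * RoeLike.rho E p μ g - RoeLike.rho E p μ g * b ∈
              RoeLike.KIdeal (B : Set (Lp E p μ →L[ℂ] Lp E p μ)),
          b ∈ RoeLike.Roe (B : Set (Lp E p μ →L[ℂ] Lp E p μ))]) := by
  by_cases hX : Nonempty X
  · obtain ⟨x₀⟩ := hX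
    have h12 : (∀ F ∈ RoeLike.VLInfty E p μ,
        RoeLike.SeqAlg.const b * F - F * RoeLike.SeqAlg.const b = 0) ↔
        RoeLike.IsQuasiLocal b := by
      rw [RoeLike.forall_mem_VLInfty_iff]
      exact ⟨RoeLike.isQuasiLocal_of_tendsto_commutator, fun h _ hf => h.tendsto_commutator hp hf⟩
    have h23 : RoeLike.IsQuasiLocal b ↔ ∀ g : BoundedContinuousFunction X ℂ, RoeLike.IsHigson g →
        b * RoeLike.rho E p μ g - RoeLike.rho E p μ g * b ∈
          RoeLike.KIdeal (B : Set (Lp E p μ →L[ℂ] Lp E p μ)) :=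
      ⟨fun h _ hg => h.commutator_mem_KIdeal hp x₀ hBmul hb hg, fun h =>
        RoeLike.isQuasiLocal_of_tendsto_commutator fun _ hf =>
          RoeLike.tendsto_commutator_of_forall_isHigson hp x₀ h hf⟩
    refine ⟨?_, fun hS => ?_⟩
    · tfae_have 1 ↔ 2 := h12
      tfae_have 2 ↔ 3 := h23
      tfae_finish
    · have h24 : RoeLike.IsQuasiLocal b ↔
          b ∈ RoeLike.Roe (B : Set (Lp E p μ →L[ℂ] Lp E p μ)) :=
        ⟨fun h => h.mem_Roe hp x₀ hS hBcut hb, RoeLike.isQuasiLocal_of_mem_Roe⟩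
      tfae_have 1 ↔ 2 := h12
      tfae_have 2 ↔ 3 := h23
      tfae_have 2 ↔ 4 := h24
      tfae_finish
  -- An empty space has no base point for the cutoffs; there `L^p` is zero and all four conditions
  -- hold trivially.
  · have hsub : ∀ S T : Lp E p μ →L[ℂ] Lp E p μ, S = T := fun S T => by
      ext1 ξ
      refine Lp.ext (.of_forall fun x => (hX ⟨x⟩).elim)
    have h2 : RoeLike.IsQuasiLocal b := fun ε hε => ⟨0, le_rfl, fun f f' _ _ _ => by
      rw [hsub (RoeLike.rho E p μ f * b * RoeLike.rho E p μ f') 0, norm_zero]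
      exact hε⟩
    have h1 : ∀ F ∈ RoeLike.VLInfty E p μ,
        RoeLike.SeqAlg.const b * F - F * RoeLike.SeqAlg.const b = 0 :=
      (RoeLike.forall_mem_VLInfty_iff b).2 fun _ hf => h2.tendsto_commutator hp hf
    have h3 : ∀ g : BoundedContinuousFunction X ℂ, RoeLike.IsHigson g →
        b * RoeLike.rho E p μ g - RoeLike.rho E p μ g * b ∈
          RoeLike.KIdeal (B : Set (Lp E p μ →L[ℂ] Lp E p μ)) := fun g _ =>
      subset_closure ⟨0, b, hb, 0, hsub _ _⟩
    have h4 : b ∈ RoeLike.Roe (B : Set (Lp E p μ →L[ℂ] Lp E p μ)) :=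
      subset_closure ⟨hb, 0, le_rfl, fun _ _ _ => hsub _ _⟩
    refine ⟨?_, fun _ => ?_⟩ <;> simp only [List.tfae_cons_cons, List.tfae_singleton]
    · tauto
    · tauto
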